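/- Conventions. For a poset $P$ and an integer $n\ge 1$, let $P^{\oplus n}=[n]\times P$ (with $[n]=\{1,\dots,n\}$) be the linear sum of $n$ copies of $P$, ordered lexicographically, and let $C_n(P)=(P\times[n],C,R_n)$, where $C(x,y,z)$ is the cyclic order induced by $P^{\oplus n}$ (that is, $x<y<z$ or $y<z<x$ or $z<x<y$ in $P^{\oplus n}$), $R_n(p,i)=(p,i+1)$ for $i<n$ and $R_n(p,n)=(p,1)$. A poset $Q$ is *cyclically three-splitting* if for every $n\ge 1$ the embeddings $C_n(Q)\to C_n(Q^{\oplus 3})$ and $C_n(Q^{\oplus 2})\to C_n(Q^{\oplus 3})$ induced by the initial embeddings of $Q$ and $Q^{\oplus 2}$ in $Q^{\oplus 3}$ are elementary. A poset $P$ is *weakly cyclically three-splitting* if there is a cyclically three-splitting poset $Q$ with $C_n(P)\cong C_n(Q)$ for every $n\ge 1$. In a monster model $\mathfrak C$ of a complete (possibly many-sorted) theory, the Lascar distance $d_L(a,b)$ of two small, possibly infinite, tuples is the least $n$ for which there are $a=a_0,a_1,\dots,a_n=b$ and $M_1,\dots,M_n\preceq\mathfrak C$ such that $a_{i-1}$ and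 $a_i$ have the same type over $M_i$ for $i=1,\dots,n$ (and $\infty$ if there is no such $n$); $a$ and $b$ have the same Lascar strong type if $d_L(a,b)<\infty$. The theory is *G-compact* if for every small tuple $a$ there is an integer $n$ such that $d_L(a,b)<\infty$ implies $d_L(a,b)\le n$. A theory $T$ is *hereditarily G-compact* if for every $M\models T$ and every (possibly many-sorted) structure $N$ interpreted in $M$ with parameters, $\mathrm{Th}(N)$ is G-compact. Theorem. Let $P$ be a nonempty weakly cyclically three-splitting poset. Then the theory of $P$ is not hereditarily G-compact. More precisely, $P$ interprets (without parameters) the many-sorted structure $(C_n(P))_{n\ge 1}$ (the disjoint union of the structures $C_n(P)$, one sort for each $n$). In every monster model of $\mathrm{Th}((C_n(P))_{n\ge1})$ there are Lascar strong types of single elements of arbitrarily large diameter: for every $m$ there are $n\ge 1$ and elements $a,b$ of the $n$-th sort with $m<d_L(a,b)<\infty$. Consequently $\mathrm{Th}((C_n(P))_{n\ge1})$ is not G-compact. -/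

import Mathlib

open FirstOrder Cardinal

universe u v w

/-! ## Many-sorted first-order logic -/

/-- A many-sorted first-order language: a type of sorts, function symbols with a list of argument
sorts and a value sort, and relation symbols with a list of argument sorts. -/
structure MSLanguage where
  Srt : Type u
  Func : List Srt → Srt → Type u
  Rel : List Srt → Type u

namespace MSLanguage

variable (L : MSLanguage.{u})

/-- The number of sorts and symbols of a many-sorted language. -/
noncomputable def card : Cardinal.{u} :=
  #(L.Srt ⊕ (Σ d : List L.Srt × L.Srt, L.Func d.1 d.2) ⊕ (Σ d : List L.Srt, L.Rel d))

/-- A structure for a many-sorted language. -/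
structure Str where
  carrier : L.Srt → Type w
  funMap : ∀ {dom : List L.Srt} {cod : L.Srt}, L.Func dom cod →
    (∀ i : Fin dom.length, carrier (dom.get i)) → carrier cod
  relMap : ∀ {dom : List L.Srt}, L.Rel dom → (∀ i : Fin dom.length, carrier (dom.get i)) → Prop

variable {L}

/-- Tuples in `M`, indexed by `ι`, whose `i`-th entry has sort `σ i`. -/
abbrev Str.Tuple (M : L.Str) {ι : Type v} (σ : ι → L.Srt) : Type _ :=
  ∀ i, M.carrier (σ i)

/-- Concatenation of two tuples. -/
def Str.Tuple.append {M : L.Str} {ι : Type v} {κ : Type w} {σ : ι → L.Srt} {τ : κ → L.Srt}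
    (a : M.Tuple σ) (b : M.Tuple τ) : M.Tuple (Sum.elim σ τ)
  | .inl i => a i
  | .inr j => b j

variable (L) in
/-- Terms of the sort given by the last index, with free variables `i : ι` of sort `σ i` and bound
variables of the sorts listed in `Γ`. -/
inductive Term {ι : Type v} (σ : ι → L.Srt) (Γ : List L.Srt) : L.Srt → Type (max u v)
  | var (i : ι) : Term σ Γ (σ i)
  | bvar (i : Fin Γ.length) : Term σ Γ (Γ.get i)
  | app {dom : List L.Srt} {cod : L.Srt} (f : L.Func dom cod)
      (ts : ∀ i : Fin dom.length, Term σ Γ (dom.get i)) : Term σ Γ cod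

variable (L) in
/-- First-order formulas with free variables `i : ι` of sort `σ i` and bound variables of the sorts
listed in the last index; a quantifier over the sort `s` binds the first variable of the list
`s :: Γ`. -/
inductive BFormula {ι : Type v} (σ : ι → L.Srt) : List L.Srt → Type (max u v)
  | falsum {Γ : List L.Srt} : BFormula σ Γ
  | equal {Γ : List L.Srt} {s : L.Srt} (t₁ t₂ : Term L σ Γ s) : BFormula σ Γ
  | rel {Γ : List L.Srt} {dom : List L.Srt} (R : L.Rel dom)
      (ts : ∀ i : Fin dom.length, Term L σ Γ (dom.get i)) : BFormula σ Γ
  | imp {Γ : List L.Srt} (φ ψ : BFormula σ Γ) : BFormula σ Γ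
  | all {Γ : List L.Srt} (s : L.Srt) (φ : BFormula σ (s :: Γ)) : BFormula σ Γ

variable (L) in
/-- First-order formulas with free variables `i : ι` of sort `σ i`. -/
abbrev Formula {ι : Type v} (σ : ι → L.Srt) : Type (max u v) := BFormula L σ []

variable (L) in
/-- Sentences. -/
abbrev Sentence : Type u := Formula L (fun i : PEmpty.{u + 1} => i.elim)

variable (L) in
/-- Theories. -/
abbrev Theory : Type u := Set (Sentence L)

namespace Str

/-- The value of a term. -/
def termVal (M : L.Str) {ι : Type v} {σ : ι → L.Srt} (a : M.Tuple σ) {Γ : List L.Srt}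
    (b : M.Tuple Γ.get) : ∀ {s : L.Srt}, Term L σ Γ s → M.carrier s
  | _, .var i => a i
  | _, .bvar i => b i
  | _, .app f ts => M.funMap f fun i => M.termVal a b (ts i)

/-- Prolonging the values of the bound variables by the value of a new first one. -/
def consTuple (M : L.Str) {s : L.Srt} {Γ : List L.Srt} (x : M.carrier s) (b : M.Tuple Γ.get) :
    M.Tuple (s :: Γ).get :=
  Fin.cons (α := fun i => M.carrier ((s :: Γ).get i)) x b

/-- Satisfaction of formulas with bound variables. -/
def BRealize (M : L.Str) {ι : Type v} {σ : ι → L.Srt} (a : M.Tuple σ) :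
    ∀ {Γ : List L.Srt}, BFormula L σ Γ → M.Tuple Γ.get → Prop
  | _, .falsum, _ => False
  | _, .equal t₁ t₂, b => M.termVal a b t₁ = M.termVal a b t₂
  | _, .rel R ts, b => M.relMap R fun i => M.termVal a b (ts i)
  | _, .imp φ ψ, b => M.BRealize a φ b → M.BRealize a ψ b
  | _, .all _ φ, b => ∀ x, M.BRealize a φ (M.consTuple x b)

/-- `M ⊨ φ(a)`. -/
def Realize (M : L.Str) {ι : Type v} {σ : ι → L.Srt} (φ : Formula L σ) (a : M.Tuple σ) : Prop :=
  M.BRealize a φ fun i => i.elim0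

/-- The complete theory of a structure. -/
def theory (M : L.Str) : Theory L := {φ | M.Realize φ fun i => i.elim}

/-- `M` is a model of `T`. -/
def Models (M : L.Str) (T : Theory L) : Prop := T ⊆ M.theory

/-- Elementary embeddings. -/
structure ElemEmb (M : L.Str.{u, v}) (N : L.Str.{u, w}) where
  toFun : ∀ s, M.carrier s → N.carrier s
  realize_iff : ∀ {ι : Type u} {σ : ι → L.Srt} (φ : Formula L σ) (a : M.Tuple σ),
    N.Realize φ (fun i => toFun (σ i) (a i)) ↔ M.Realize φ a

/-- Automorphisms. -/
structure Aut (M : L.Str) where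
  toEquiv : ∀ s, M.carrier s ≃ M.carrier s
  map_fun : ∀ {dom : List L.Srt} {cod : L.Srt} (f : L.Func dom cod) (a : M.Tuple dom.get),
    toEquiv cod (M.funMap f a) = M.funMap f (fun i => toEquiv (dom.get i) (a i))
  map_rel : ∀ {dom : List L.Srt} (R : L.Rel dom) (a : M.Tuple dom.get),
    M.relMap R (fun i => toEquiv (dom.get i) (a i)) ↔ M.relMap R a

/-! ## Monster models, Lascar distance and G-compactness -/

/-- The tuples `a` and `b` have the same type over the tuple `c`. -/
def EqTypeOver (M : L.Str) {ι : Type v} {σ : ι → L.Srt} {κ : Type w} {τ : κ → L.Srt}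
    (c : M.Tuple τ) (a b : M.Tuple σ) : Prop :=
  ∀ φ : Formula L (Sum.elim σ τ), M.Realize φ (a.append c) ↔ M.Realize φ (b.append c)

/-- The tuples `a` and `b` have the same type over `∅`. -/
def EqType (M : L.Str) {ι : Type v} {σ : ι → L.Srt} (a b : M.Tuple σ) : Prop :=
  ∀ φ : Formula L σ, M.Realize φ a ↔ M.Realize φ b

/-- `κ`-saturation: every finitely satisfiable set of formulas in fewer than `κ` variables and with
fewer than `κ` parameters is realised. (For infinite `κ` it is equivalent to require this for sets
of formulas in one variable.) -/
def IsSaturated (M : L.Str.{u, u}) (κ : Cardinal.{u}) : Prop :=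
  ∀ (ι J : Type u) (σ : ι → L.Srt) (τ : J → L.Srt), #ι < κ → #J < κ →
    ∀ (c : M.Tuple τ) (p : Set (Formula L (Sum.elim σ τ))),
      (∀ q ⊆ p, q.Finite → ∃ a : M.Tuple σ, ∀ φ ∈ q, M.Realize φ (a.append c)) →
        ∃ a : M.Tuple σ, ∀ φ ∈ p, M.Realize φ (a.append c)

/-- Strong `κ`-homogeneity: every elementary map between sets of size less than `κ` extends to an
automorphism. -/
def IsStronglyHomogeneous (M : L.Str.{u, u}) (κ : Cardinal.{u}) : Prop :=
  ∀ (ι : Type u) (σ : ι → L.Srt), #ι < κ → ∀ a b : M.Tuple σ, M.EqType a b →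
    ∃ g : M.Aut, ∀ i, g.toEquiv (σ i) (a i) = b i

/-- `M` is a monster model (of its theory), where "small" means "of size less than `κ`": the
cardinal `κ` exceeds the number of formulas, and `M` is `κ`-saturated and strongly
`κ`-homogeneous. -/
structure IsMonster (M : L.Str.{u, u}) (κ : Cardinal.{u}) : Prop where
  lt : max ℵ₀ L.card < κ
  saturated : M.IsSaturated κ
  homogeneous : M.IsStronglyHomogeneous κ

/-- Adjacency in the Lascar graph: `a` and `b` have the same type over some elementary
substructure, given here as the image of an elementary embedding `f : N → M`. -/
def LascarAdj (M : L.Str.{u, u}) {ι : Type v} {σ : ι → L.Srt} (a b : M.Tuple σ) : Prop :=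
  ∃ (N : L.Str.{u, u}) (f : N.ElemEmb M),
    M.EqTypeOver (τ := fun x : (Σ s, N.carrier s) => x.1) (fun x => f.toFun x.1 x.2) a b

/-- The Lascar distance of `a` and `b` is at most `n`. -/
def LascarLE (M : L.Str.{u, u}) {ι : Type v} {σ : ι → L.Srt} (n : ℕ) (a b : M.Tuple σ) : Prop :=
  ∃ x : ℕ → M.Tuple σ, x 0 = a ∧ x n = b ∧ ∀ i < n, M.LascarAdj (x i) (x (i + 1))

/-- The Lascar distance: the least `n` with `M.LascarLE n a b`, or `⊤` if there is none. -/
noncomputable def lascarDist (M : L.Str.{u, u}) {ι : Type v} {σ : ι → L.Srt} (a b : M.Tuple σ) :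
    ℕ∞ :=
  ⨅ (n : ℕ) (_ : M.LascarLE n a b), (n : ℕ∞)

/-- Equality of Lascar strong types. -/
def LascarEquiv (M : L.Str.{u, u}) {ι : Type v} {σ : ι → L.Srt} (a b : M.Tuple σ) : Prop :=
  M.lascarDist a b < ⊤

end Str

/-- A (complete) theory is G-compact if in a monster model of it, the Lascar strong type of every
small tuple has finite diameter. (This does not depend on the choice of the monster model.) -/
def Theory.IsGCompact {L : MSLanguage.{u}} (T : Theory L) : Prop :=
  ∃ (κ : Cardinal.{u}) (C : L.Str.{u, u}), C.IsMonster κ ∧ C.Models T ∧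
    ∀ (ι : Type u) (σ : ι → L.Srt), #ι < κ → ∀ a : C.Tuple σ,
      ∃ n : ℕ, ∀ b : C.Tuple σ, C.LascarEquiv a b → C.lascarDist a b ≤ n

end MSLanguage

/-! ## Interpretations and hereditary G-compactness -/

/-- An interpretation, with parameters from `A`, of a many-sorted structure `N` in a one-sorted
structure `M`: every sort of `N` is the quotient of an `A`-definable set of finite tuples by an
`A`-definable equivalence relation (the kernel of `proj`), in such a way that the relations and the
graphs of the functions of `N` pull back to `A`-definable sets. -/
structure MSInterpretation (L : FirstOrder.Language.{v, w}) (M : Type u) [L.Structure M] (A : Set M)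
    {L' : MSLanguage.{u}} (N : L'.Str.{u, u}) where
  dim : L'.Srt → ℕ
  dom : ∀ s, Set (Fin (dim s) → M)
  proj : ∀ s, dom s → N.carrier s
  proj_surjective : ∀ s, Function.Surjective (proj s)
  dom_definable : ∀ s, A.Definable L (dom s)
  eq_definable : ∀ s, A.Definable L
    {v : Fin (dim s) ⊕ Fin (dim s) → M |
      ∃ (h₁ : (fun j => v (.inl j)) ∈ dom s) (h₂ : (fun j => v (.inr j)) ∈ dom s),
        proj s ⟨_, h₁⟩ = proj s ⟨_, h₂⟩}
  rel_definable : ∀ {ar : List L'.Srt} (R : L'.Rel ar), A.Definable L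
    {v : (Σ i : Fin ar.length, Fin (dim (ar.get i))) → M |
      ∃ h : ∀ i, (fun j => v ⟨i, j⟩) ∈ dom (ar.get i),
        N.relMap R fun i => proj (ar.get i) ⟨_, h i⟩}
  fun_definable : ∀ {ar : List L'.Srt} {s : L'.Srt} (f : L'.Func ar s), A.Definable L
    {v : (Σ i : Fin ar.length, Fin (dim (ar.get i))) ⊕ Fin (dim s) → M |
      ∃ (h : ∀ i, (fun j => v (.inl ⟨i, j⟩)) ∈ dom (ar.get i))
        (h' : (fun j => v (.inr j)) ∈ dom s),
        N.funMap f (fun i => proj (ar.get i) ⟨_, h i⟩) = proj s ⟨_, h'⟩}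

/-- A one-sorted theory `T` is hereditarily G-compact if the theory of every (many-sorted)
structure which is interpreted, with parameters, in a model of `T` is G-compact. -/
def HereditarilyGCompact {L : FirstOrder.Language.{v, w}} (T : L.Theory) : Prop :=
  ∀ (M : Type u) [L.Structure M] [Nonempty M] [M ⊨ T] (L' : MSLanguage.{u}) (N : L'.Str.{u, u}),
    Nonempty (MSInterpretation L M Set.univ N) → N.theory.IsGCompact

/-! ## The cyclic structures `C_n(P)` -/

/-- The linear sum of `n` copies of the poset `P`, that is, `[n] × P` ordered lexicographically. -/
abbrev LinPow (n : ℕ) (P : Type u) : Type u := Fin n ×ₗ P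

/-- The underlying set of `C_n(P)`. -/
def CyclicPow (n : ℕ+) (P : Type u) : Type u := LinPow n P

namespace CyclicPow

variable {n : ℕ+} {P : Type u}

/-- The element of the `i`-th copy of `P` which corresponds to `p`. -/
def mk (p : P) (i : Fin n) : CyclicPow n P := toLex (i, p)

/-- The order of the linear sum of `n` copies of `P`. -/
def lt [PartialOrder P] (x y : CyclicPow n P) : Prop :=
  @LT.lt (LinPow n P) _ x y

/-- The (strict, partial) cyclic order induced by the order of the linear sum. -/
def C [PartialOrder P] (x y z : CyclicPow n P) : Prop :=
  (lt x y ∧ lt y z) ∨ (lt y z ∧ lt z x) ∨ (lt z x ∧ lt x y)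

/-- The map `R_n`, which shifts each copy to the next one and the last copy to the first one. -/
def rot (x : CyclicPow n P) : CyclicPow n P := mk (ofLex x).2 (finRotate n (ofLex x).1)

end CyclicPow

/-- The only function symbol of the language of the structures `C_n(P)` is unary. -/
inductive CyclicFunc : ℕ → Type
  | rot : CyclicFunc 1

/-- The only relation symbol of the language of the structures `C_n(P)` is ternary. -/
inductive CyclicRel : ℕ → Type
  | cyc : CyclicRel 3

/-- The language of the structures `C_n(P) = (P × [n], C, R_n)`. -/
def cyclicLanguage : FirstOrder.Language.{0, 0} := ⟨CyclicFunc, CyclicRel⟩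

/-- The structure `C_n(P)`. -/
instance CyclicPow.structure (n : ℕ+) (P : Type u) [PartialOrder P] :
    cyclicLanguage.Structure (CyclicPow n P) where
  funMap | .rot, x => CyclicPow.rot (x 0)
  RelMap | .cyc, x => CyclicPow.C (x 0) (x 1) (x 2)

/-- `P` is cyclically three-splitting: for all `n`, the embeddings of `C_n(P)` and of
`C_n(P ⊕ P)` in `C_n(P ⊕ P ⊕ P)`, induced by the inclusions of the first summand and of the first
two summands, are elementary. -/
def CyclicallyThreeSplitting (P : Type u) [PartialOrder P] : Prop :=
  ∀ n : ℕ+,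
    (∃ f : CyclicPow n P ↪ₑ[cyclicLanguage] CyclicPow n (LinPow 3 P),
      ∀ (p : P) (i : Fin n), f (CyclicPow.mk p i) = CyclicPow.mk (toLex (0, p)) i) ∧
    (∃ f : CyclicPow n (LinPow 2 P) ↪ₑ[cyclicLanguage] CyclicPow n (LinPow 3 P),
      ∀ (p : P) (j : Fin 2) (i : Fin n),
        f (CyclicPow.mk (toLex (j, p)) i) = CyclicPow.mk (toLex (j.castSucc, p)) i)

/-- `P` is weakly cyclically three-splitting: the structures `C_n(P)` are isomorphic to those of
some cyclically three-splitting poset. -/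
def WeaklyCyclicallyThreeSplitting (P : Type u) [PartialOrder P] : Prop :=
  ∃ (Q : Type u) (_ : PartialOrder Q), CyclicallyThreeSplitting Q ∧
    ∀ n : ℕ+, Nonempty (CyclicPow n P ≃[cyclicLanguage] CyclicPow n Q)

/-- The sorts of the many-sorted structure `(C_n(P))_n`: one for every positive integer. -/
structure CyclicSort : Type u where
  idx : ℕ+

/-- The function symbols of the language of `(C_n(P))_n`: for every `n`, the symbol `R_n`. -/
inductive CyclicFamilyFunc : List CyclicSort.{u} → CyclicSort.{u} → Type u
  | rot (s : CyclicSort.{u}) : CyclicFamilyFunc [s] s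

/-- The relation symbols of the language of `(C_n(P))_n`: for every `n`, the symbol `C` on the
`n`-th sort. -/
inductive CyclicFamilyRel : List CyclicSort.{u} → Type u
  | cyc (s : CyclicSort.{u}) : CyclicFamilyRel [s, s, s]

/-- The language of the many-sorted structure `(C_n(P))_n`. -/
def cyclicFamilyLanguage : MSLanguage.{u} := ⟨CyclicSort, CyclicFamilyFunc, CyclicFamilyRel⟩

/-- The many-sorted structure `(C_n(P))_n`, the disjoint union of the structures `C_n(P)`. -/
def cyclicFamily (P : Type u) [PartialOrder P] : cyclicFamilyLanguage.{u}.Str.{u, u} where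
  carrier s := CyclicPow s.idx P
  funMap | .rot _, x => CyclicPow.rot (x 0)
  relMap | .cyc _, x => CyclicPow.C (x 0) (x 1) (x 2)

/-- The singleton tuple given by an element of the `n`-th sort of a structure in the language of
`(C_n(P))_n`. -/
def cyclicSingle {M : cyclicFamilyLanguage.{u}.Str.{u, u}} {n : ℕ+} (a : M.carrier ⟨n⟩) :
    M.Tuple (fun _ : Unit => (⟨n⟩ : CyclicSort.{u})) :=
  fun _ => a

/-! The circle $C_n(Q^{\oplus 3})$ consists of $3n$ copies of $Q$, grouped into triples with places
0, 1, 2. The shift $S$ by one copy is an automorphism, and $S^3=R_n$. Composing the given embeddings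
with shifts, one sees that the copies in places 0 and 2 form an elementary substructure, as do those
in places 1 and 2, and those in place 2 alone. Hence a point in place 0 and its shift in place 1
have the same type over the model formed by place 2. Applying powers of $S$ yields a sequence in
which neighbours are conjugate over a model and three steps make one rotation
(`exists_elementaryEmbedding_sequences`).

Conversely, let $e$ lie in a model. For $n\ge 3$ the arcs from $R_n^k e$ to $R_n^{k+2}e$ cover the
circle, so two elements with the same type over the model lie on a common arc (`near_of_lascarAdj`),
and one Lascar step changes the index of the copy by at most 2 modulo $n$. For $n=4m+3$ the rotation
$R_n^{2m+1}$ thus needs more than $m$ steps (`lt_lascarDist`), although finitely many suffice. In a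
fixed sort all of this is expressed by sentences, so it holds in every model.

To find the sequence in a monster model, in all sorts at once, note that a formula about a disjoint
union is determined by finitely many one-sorted formulas in each sort (`exists_local_formulas`), so
that sortwise elementary maps combine. Countable elementary submodels make the configuration a small
tuple, whose type is then realised (`exists_lascarAdj_sequence`). The resulting tuple with one entry
in each sort has a Lascar strong type of infinite diameter, which refutes G-compactness.

The interpretation in $P$ codes the index of a copy by the equality pattern of a tuple, for which
$P$ must have two elements. -/

namespace MSLanguage

variable {L : MSLanguage.{u}}

/-! ## Substitution -/

/-- Simultaneous substitution of terms for all the variables of a term. -/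
def Term.subst {ι : Type v} {ι' : Type w} {σ : ι → L.Srt} {σ' : ι' → L.Srt} {Γ Γ' : List L.Srt}
    (θ : ∀ i, Term L σ' Γ' (σ i)) (η : ∀ j : Fin Γ.length, Term L σ' Γ' (Γ.get j)) :
    ∀ {s : L.Srt}, Term L σ Γ s → Term L σ' Γ' s
  | _, .var i => θ i
  | _, .bvar j => η j
  | _, .app f ts => .app f fun i => (ts i).subst θ η

/-- Weakening of a term by a new first bound variable. -/
def Term.lift {ι : Type v} {σ : ι → L.Srt} {Γ : List L.Srt} (s' : L.Srt) {s : L.Srt}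
    (t : Term L σ Γ s) : Term L σ (s' :: Γ) s :=
  t.subst (fun i => .var i) (fun j => .bvar (Γ := s' :: Γ) j.succ)

/-- The first bound variable. -/
def Term.bvarZero {ι : Type v} {σ : ι → L.Srt} {Γ : List L.Srt} {s : L.Srt} :
    Term L σ (s :: Γ) s :=
  .bvar (Γ := s :: Γ) ⟨0, Nat.succ_pos _⟩

/-- Simultaneous substitution of terms for all the variables of a formula. -/
def BFormula.subst {ι : Type v} {ι' : Type w} {σ : ι → L.Srt} {σ' : ι' → L.Srt} :
    ∀ {Γ : List L.Srt}, BFormula L σ Γ → ∀ {Γ' : List L.Srt}, (∀ i, Term L σ' Γ' (σ i)) →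
      (∀ j : Fin Γ.length, Term L σ' Γ' (Γ.get j)) → BFormula L σ' Γ'
  | _, .falsum, _, _, _ => .falsum
  | _, .equal t₁ t₂, _, θ, η => .equal (t₁.subst θ η) (t₂.subst θ η)
  | _, .rel R ts, _, θ, η => .rel R fun i => (ts i).subst θ η
  | _, .imp φ ψ, _, θ, η => .imp (φ.subst θ η) (ψ.subst θ η)
  | Γ, .all s φ, Γ', θ, η => .all s (φ.subst (fun i => (θ i).lift s)
      (Fin.cases (motive := fun j : Fin (Γ.length + 1) => Term L σ' (s :: Γ') ((s :: Γ).get j))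
        Term.bvarZero fun j => (η j).lift s))

/-- Negation. -/
def BFormula.neg {ι : Type v} {σ : ι → L.Srt} {Γ : List L.Srt} (φ : BFormula L σ Γ) :
    BFormula L σ Γ :=
  .imp φ .falsum

/-- Conjunction. -/
def BFormula.conj {ι : Type v} {σ : ι → L.Srt} {Γ : List L.Srt} (φ ψ : BFormula L σ Γ) :
    BFormula L σ Γ :=
  (BFormula.imp φ ψ.neg).neg

/-- Existential quantification. -/
def BFormula.ex {ι : Type v} {σ : ι → L.Srt} {Γ : List L.Srt} (s : L.Srt)
    (φ : BFormula L σ (s :: Γ)) : BFormula L σ Γ :=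
  (BFormula.all s φ.neg).neg

/-- Renaming the free variables of a formula. -/
def Formula.rename {ι : Type v} {ι' : Type w} {σ : ι → L.Srt} {σ' : ι' → L.Srt}
    (φ : Formula L σ) (θ : ∀ i, Term L σ' [] (σ i)) : Formula L σ' :=
  BFormula.subst φ θ fun j => j.elim0

namespace Str

/-- The values of no bound variables. -/
def nilTuple (M : L.Str) : M.Tuple ([] : List L.Srt).get :=
  fun i => i.elim0

variable {M : L.Str} {ι : Type v} {ι' : Type w} {σ : ι → L.Srt} {σ' : ι' → L.Srt}

theorem termVal_subst (a : M.Tuple σ') {Γ Γ' : List L.Srt} (b : M.Tuple Γ'.get)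
    (θ : ∀ i, Term L σ' Γ' (σ i)) (η : ∀ j : Fin Γ.length, Term L σ' Γ' (Γ.get j)) {s : L.Srt}
    (t : Term L σ Γ s) :
    M.termVal a b (t.subst θ η) =
      M.termVal (fun i => M.termVal a b (θ i)) (fun j => M.termVal a b (η j)) t := by
  induction t with
  | var i => rfl
  | bvar j => rfl
  | app f ts ih => simp only [Term.subst, termVal, ih]

@[simp]
theorem termVal_bvarZero (a : M.Tuple σ) {Γ : List L.Srt} (b : M.Tuple Γ.get) {s : L.Srt}
    (x : M.carrier s) : M.termVal a (M.consTuple x b) (Term.bvarZero : Term L σ (s :: Γ) s) = x :=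
  rfl

@[simp]
theorem termVal_lift (a : M.Tuple σ) {Γ : List L.Srt} (b : M.Tuple Γ.get) {s s' : L.Srt}
    (x : M.carrier s') (t : Term L σ Γ s) :
    M.termVal a (M.consTuple x b) (t.lift s') = M.termVal a b t := by
  rw [Term.lift, termVal_subst]; rfl

theorem bRealize_subst {Γ : List L.Srt} (φ : BFormula L σ Γ) {Γ' : List L.Srt} (a : M.Tuple σ')
    (b : M.Tuple Γ'.get) (θ : ∀ i, Term L σ' Γ' (σ i))
    (η : ∀ j : Fin Γ.length, Term L σ' Γ' (Γ.get j)) :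
    M.BRealize a (φ.subst θ η) b ↔
      M.BRealize (fun i => M.termVal a b (θ i)) φ (fun j => M.termVal a b (η j)) := by
  induction φ generalizing Γ' with
  | falsum => rfl
  | equal t₁ t₂ => simp only [BFormula.subst, BRealize, termVal_subst]
  | rel R ts => simp only [BFormula.subst, BRealize, termVal_subst]
  | imp φ ψ ih₁ ih₂ => simp only [BFormula.subst, BRealize, ih₁, ih₂]
  | @all Γ s φ ih =>
    simp only [BFormula.subst, BRealize, ih, termVal_lift]
    refine forall_congr' fun x => ?_
    have : (fun j => M.termVal a (M.consTuple x b)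
        (Fin.cases (motive := fun j : Fin (Γ.length + 1) => Term L σ' (s :: Γ') ((s :: Γ).get j))
        Term.bvarZero (fun j => (η j).lift s) j)) =
        M.consTuple x (fun j => M.termVal a b (η j)) := by
      funext j
      induction j using Fin.cases with
      | zero => rfl
      | succ j => exact termVal_lift a b x (η j)
    rw [← this]
    rfl

@[simp]
theorem bRealize_neg {Γ : List L.Srt} (φ : BFormula L σ Γ) (a : M.Tuple σ) (b : M.Tuple Γ.get) :
    M.BRealize a φ.neg b ↔ ¬ M.BRealize a φ b :=
  Iff.rfl

@[simp]
theorem bRealize_conj {Γ : List L.Srt} (φ ψ : BFormula L σ Γ) (a : M.Tuple σ)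
    (b : M.Tuple Γ.get) : M.BRealize a (φ.conj ψ) b ↔ M.BRealize a φ b ∧ M.BRealize a ψ b := by
  simp only [BFormula.conj, bRealize_neg, BRealize]; tauto

@[simp]
theorem bRealize_ex {Γ : List L.Srt} {s : L.Srt} (φ : BFormula L σ (s :: Γ)) (a : M.Tuple σ)
    (b : M.Tuple Γ.get) :
    M.BRealize a (φ.ex s) b ↔ ∃ x, M.BRealize a φ (M.consTuple x b) := by
  simp [BFormula.ex, BRealize]

theorem realize_rename (φ : Formula L σ) (θ : ∀ i, Term L σ' [] (σ i)) (a : M.Tuple σ') :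
    M.Realize (φ.rename θ) a ↔ M.Realize φ (fun i => M.termVal a M.nilTuple (θ i)) := by
  rw [Realize, Formula.rename, bRealize_subst, Realize]
  exact iff_of_eq (congrArg _ (funext fun j => j.elim0))

end Str

/-! ## Finite support and existential closure -/

/-- Enlarging the set of the free variables of a term. -/
def Term.widen {ι : Type v} {σ : ι → L.Srt} {S T : Set ι} (h : S ⊆ T) {Γ : List L.Srt}
    {s : L.Srt} (t : Term L (fun i : S => σ i) Γ s) : Term L (fun i : T => σ i) Γ s :=
  Term.subst (σ := fun i : S => σ i) 
    (fun k : S => .var (σ := fun i : T => σ i) ⟨k, h k.2⟩) (fun j => .bvar j) t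

/-- Enlarging the set of the free variables of a formula. -/
def BFormula.widen {ι : Type v} {σ : ι → L.Srt} {S T : Set ι} (h : S ⊆ T) {Γ : List L.Srt}
    (φ : BFormula L (fun i : S => σ i) Γ) : BFormula L (fun i : T => σ i) Γ :=
  BFormula.subst (σ := fun i : S => σ i) φ 
    (fun k : S => .var (σ := fun i : T => σ i) ⟨k, h k.2⟩) (fun j => .bvar j)

theorem Str.termVal_widen {M : L.Str} {ι : Type v} {σ : ι → L.Srt} {S T : Set ι} (h : S ⊆ T)
    {Γ : List L.Srt} {s : L.Srt} (t : Term L (fun i : S => σ i) Γ s) (a : M.Tuple σ)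
    (b : M.Tuple Γ.get) :
    M.termVal (fun i : T => a i) b (t.widen h) = M.termVal (fun i : S => a i) b t :=
  termVal_subst _ _ _ _ _

theorem Str.bRealize_widen {M : L.Str} {ι : Type v} {σ : ι → L.Srt} {S T : Set ι} (h : S ⊆ T)
    {Γ : List L.Srt} (φ : BFormula L (fun i : S => σ i) Γ) (a : M.Tuple σ)
    (b : M.Tuple Γ.get) :
    M.BRealize (fun i : T => a i) (φ.widen h) b ↔ M.BRealize (fun i : S => a i) φ b :=
  bRealize_subst _ _ _ _ _

theorem Term.exists_finite_support {ι : Type v} {σ : ι → L.Srt} {Γ : List L.Srt} {s : L.Srt}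
    (t : Term L σ Γ s) : ∃ (S : Set ι) (_ : S.Finite) (t' : Term L (fun i : S => σ i) Γ s),
      ∀ (M : L.Str.{u, u}) (a : M.Tuple σ) (b : M.Tuple Γ.get),
        M.termVal (fun i : S => a i) b t' = M.termVal a b t := by
  induction t with
  | var i =>
    exact ⟨{i}, Set.finite_singleton i, .var (σ := fun k : ({i} : Set ι) => σ k) ⟨i, rfl⟩,
      fun _ _ _ => rfl⟩
  | bvar j => exact ⟨∅, Set.finite_empty, .bvar j, fun _ _ _ => rfl⟩
  | app f ts ih =>
    choose S hS t' ht' using ih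
    refine ⟨⋃ i, S i, Set.finite_iUnion hS,
      .app f fun i => (t' i).widen (Set.subset_iUnion S i), fun M a b => ?_⟩
    simp only [Str.termVal, Str.termVal_widen, ← ht']

theorem BFormula.exists_finite_support {ι : Type v} {σ : ι → L.Srt} {Γ : List L.Srt}
    (φ : BFormula L σ Γ) :
    ∃ (S : Set ι) (_ : S.Finite) (φ' : BFormula L (fun i : S => σ i) Γ),
      ∀ (M : L.Str.{u, u}) (a : M.Tuple σ) (b : M.Tuple Γ.get),
        M.BRealize (fun i : S => a i) φ' b ↔ M.BRealize a φ b := by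
  induction φ with
  | falsum => exact ⟨∅, Set.finite_empty, .falsum, fun _ _ _ => Iff.rfl⟩
  | equal t₁ t₂ =>
    obtain ⟨S₁, h₁, t₁', ht₁⟩ := t₁.exists_finite_support
    obtain ⟨S₂, h₂, t₂', ht₂⟩ := t₂.exists_finite_support
    refine ⟨S₁ ∪ S₂, h₁.union h₂, .equal (t₁'.widen Set.subset_union_left)
        (t₂'.widen Set.subset_union_right), fun M a b => ?_⟩
    simp only [Str.BRealize, Str.termVal_widen, ← ht₁, ← ht₂]
  | rel R ts =>
    choose S hS t' ht' using fun i => (ts i).exists_finite_support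
    refine ⟨⋃ i, S i, Set.finite_iUnion hS,
      .rel R fun i => (t' i).widen (Set.subset_iUnion S i), fun M a b => ?_⟩
    simp only [Str.BRealize, Str.termVal_widen, ← ht']
  | imp φ ψ ih₁ ih₂ =>
    obtain ⟨S₁, h₁, φ', hφ⟩ := ih₁
    obtain ⟨S₂, h₂, ψ', hψ⟩ := ih₂
    refine ⟨S₁ ∪ S₂, h₁.union h₂, .imp (φ'.widen Set.subset_union_left)
        (ψ'.widen Set.subset_union_right), fun M a b => ?_⟩
    simp only [Str.BRealize, Str.bRealize_widen, ← hφ, ← hψ]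
  | all s φ ih =>
    obtain ⟨S, hS, φ', hφ⟩ := ih
    exact ⟨S, hS, .all s φ', fun M a b => forall_congr' fun x => hφ M a _⟩

/-- The free variables are bound one at a time: the variable 0 becomes the quantified one, the
others move down by one. -/
theorem Formula.exists_sentence_of_fin : ∀ {k : ℕ} {σ : Fin k → L.Srt} (φ : Formula L σ),
    ∃ χ : Sentence L, ∀ M : L.Str.{u, u},
      M.Realize χ (fun i => i.elim) ↔ ∃ a : M.Tuple σ, M.Realize φ a
  | 0, σ, φ => ⟨φ.rename fun i => i.elim0, fun M => by
      rw [Str.realize_rename]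
      exact ⟨fun h => ⟨_, h⟩, fun ⟨a, h⟩ => by
        convert h using 1⟩⟩
  | k + 1, σ, φ => by
    obtain ⟨χ, hχ⟩ := Formula.exists_sentence_of_fin (σ := fun i : Fin k => σ i.succ)
      (BFormula.ex (σ 0) (BFormula.subst φ (Γ' := [σ 0])
        (Fin.cases (motive := fun i => Term L (fun i : Fin k => σ i.succ) [σ 0] (σ i))
          Term.bvarZero fun i => .var i) fun j => j.elim0))
    refine ⟨χ, fun M => (hχ M).trans ?_⟩
    have key : ∀ (a : M.Tuple fun i : Fin k => σ i.succ) (x : M.carrier (σ 0)),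
        (fun i => M.termVal a (M.consTuple x M.nilTuple)
          (Fin.cases (motive := fun i => Term L (fun i : Fin k => σ i.succ) [σ 0] (σ i))
          Term.bvarZero (fun i => .var i) i)) =
        (Fin.cons (α := fun i => M.carrier (σ i)) x a : M.Tuple σ) := by
      intro a x
      funext i
      induction i using Fin.cases <;> rfl
    simp only [Str.Realize, Str.bRealize_ex, Str.bRealize_subst]
    constructor
    · rintro ⟨a, x, h⟩
      refine ⟨Fin.cons (α := fun i => M.carrier (σ i)) x a, ?_⟩
      convert h using 1
      · exact (key _ _).symm
      · exact funext fun j => j.elim0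
    · rintro ⟨a, h⟩
      refine ⟨fun i => a i.succ, a 0, ?_⟩
      convert h using 1
      · exact (key _ _).trans (Fin.cons_self_tail a)
      · exact funext fun j => j.elim0

theorem Formula.exists_sentence {ι : Type v} [Finite ι] {σ : ι → L.Srt} (φ : Formula L σ) :
    ∃ χ : Sentence L, ∀ M : L.Str.{u, u},
      M.Realize χ (fun i => i.elim) ↔ ∃ a : M.Tuple σ, M.Realize φ a := by
  obtain ⟨k, ⟨e⟩⟩ := Finite.exists_equiv_fin ι
  have : ∀ i, ∃ t : Term L (fun j => σ (e.symm j)) [] (σ i), ∀ (M : L.Str.{u, u}) (a : M.Tuple σ),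
      M.termVal (fun j => a (e.symm j)) M.nilTuple t = a i := by
    intro i
    obtain ⟨j, rfl⟩ := e.symm.surjective i
    exact ⟨.var j, fun _ _ => rfl⟩
  choose θ hθ using this
  obtain ⟨χ, hχ⟩ := Formula.exists_sentence_of_fin (φ.rename θ)
  refine ⟨χ, fun M => (hχ M).trans ?_⟩
  simp only [Str.realize_rename]
  exact ⟨fun ⟨a, h⟩ => ⟨_, h⟩, fun ⟨a, h⟩ => ⟨fun j => a (e.symm j), by simpa only [hθ] using h⟩⟩

/-! ### Transfer between models of a theory and realisation of types -/

namespace Str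

theorem Models.realize_iff {M N : L.Str.{u, u}} (h : N.Models M.theory) (φ : Sentence L) :
    N.Realize φ (fun i => i.elim) ↔ M.Realize φ (fun i => i.elim) := by
  refine ⟨fun hN => ?_, fun hM => h hM⟩
  by_contra hM
  exact h (a := BFormula.neg φ) hM hN

/-- A sort may be empty, and the sentence $\neg\forall x\,\bot$ of that sort detects this. -/
theorem Models.nonempty {M N : L.Str.{u, u}} (h : N.Models M.theory) {s : L.Srt}
    (hM : Nonempty (M.carrier s)) : Nonempty (N.carrier s) := by
  have := (h.realize_iff (BFormula.neg (.all s .falsum))).2 fun h => h hM.some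
  by_contra hN
  exact this fun x => hN ⟨x⟩

theorem Models.exists_realize {M N : L.Str.{u, u}} (h : N.Models M.theory) {ι : Type v}
    {σ : ι → L.Srt} (φ : Formula L σ) (a : M.Tuple σ) (hφ : M.Realize φ a) :
    ∃ b : N.Tuple σ, N.Realize φ b := by
  classical
  obtain ⟨S, hS, φ', hφ'⟩ := BFormula.exists_finite_support φ
  have := hS.to_subtype
  obtain ⟨χ, hχ⟩ := Formula.exists_sentence (ι := S) φ'
  obtain ⟨b, hb⟩ := (hχ N).1 ((h.realize_iff χ).2 ((hχ M).2 ⟨_, (hφ' M a _).2 hφ⟩))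
  have hne (i : ι) : Nonempty (N.carrier (σ i)) := h.nonempty ⟨a i⟩
  -- Variables outside the finite support do not matter; arbitrary values exist because their sorts
  -- are nonempty in `M`, hence in `N`.
  refine ⟨fun i => if hi : i ∈ S then b ⟨i, hi⟩ else Classical.arbitrary _, (hφ' N _ _).1 ?_⟩
  rw [Realize] at hb
  convert hb using 1
  funext i
  simp

theorem exists_conj {ι : Type v} {σ : ι → L.Srt} {q : Set (Formula L σ)} (hq : q.Finite) :
    ∃ φ : Formula L σ, ∀ (M : L.Str.{u, u}) (a : M.Tuple σ),
      M.Realize φ a ↔ ∀ ψ ∈ q, M.Realize ψ a := by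
  induction q, hq using Set.Finite.induction_on with
  | empty => exact ⟨.imp .falsum .falsum, fun M a => by simp [Realize, BRealize]⟩
  | @insert ψ q _ _ ih =>
    obtain ⟨φ, hφ⟩ := ih
    exact ⟨BFormula.conj ψ φ, fun M a => by
      rw [Realize, bRealize_conj]; exact (and_congr_right' (hφ M a)).trans (by simp [Realize])⟩

/-- A saturated model of `Th(M)` realises the type of every small tuple of `M`. -/
theorem IsSaturated.exists_realize_iff {κ : Cardinal.{u}} {M N : L.Str.{u, u}}
    (hN : N.IsSaturated κ) (h : N.Models M.theory) {ι : Type u} {σ : ι → L.Srt} (hι : #ι < κ)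
    (a : M.Tuple σ) : ∃ b : N.Tuple σ, ∀ φ : Formula L σ, N.Realize φ b ↔ M.Realize φ a := by
  let τ : PEmpty.{u + 1} → L.Srt := fun i => i.elim
  let c : N.Tuple τ := fun i => i.elim
  let up : Formula L σ → Formula L (Sum.elim σ τ) := fun φ => φ.rename fun i => .var (σ := Sum.elim σ τ) (Sum.inl i)
  have hup : ∀ φ (b : N.Tuple σ), N.Realize (up φ) (b.append c) ↔ N.Realize φ b :=
    fun φ b => realize_rename _ _ _
  obtain ⟨b, hb⟩ := hN ι PEmpty σ τ hι (by simpa using bot_lt_of_lt hι) c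
    (up '' {φ | M.Realize φ a}) (by
      intro q hq hfin
      -- The conjunction of a finite part of the type holds of `a` in `M`, so it is satisfied
      -- somewhere in `N`.
      obtain ⟨q', hq', hfin', rfl⟩ := Set.exists_subset_image_finite_and.1 ⟨q, hq, hfin, rfl⟩
      obtain ⟨φ, hφ⟩ := exists_conj hfin'
      obtain ⟨b, hb⟩ := h.exists_realize φ a ((hφ M a).2 fun ψ hψ => hq' hψ)
      refine ⟨b, ?_⟩
      rintro _ ⟨ψ, hψ, rfl⟩
      exact (hup ψ b).2 ((hφ N b).1 hb ψ hψ))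
  have hb' : ∀ φ : Formula L σ, M.Realize φ a → N.Realize φ b :=
    fun φ hφ => (hup φ b).1 (hb _ ⟨φ, hφ, rfl⟩)
  refine ⟨b, fun φ => ⟨fun hN => ?_, hb' φ⟩⟩
  by_contra hM
  exact hb' (BFormula.neg φ) hM hN

end Str

end MSLanguage

open MSLanguage

/-! ## Formulas about a disjoint union are determined by one-sorted formulas -/

/-- The interpretation of the function symbol of `cyclicLanguage`. -/
def cyclicRot {M : Type u} [cyclicLanguage.Structure M] (x : M) : M :=
  Language.Structure.funMap (L := cyclicLanguage) CyclicFunc.rot ![x]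

/-- The interpretation of the relation symbol of `cyclicLanguage`. -/
def CyclicOrd {M : Type u} [cyclicLanguage.Structure M] (x y z : M) : Prop :=
  Language.Structure.RelMap (L := cyclicLanguage) CyclicRel.cyc ![x, y, z]

/-- A structure in the language of `(C_n(P))_n`, whose sorts are viewed as one-sorted structures. -/
class SortwiseCyclic (M : cyclicFamilyLanguage.{u}.Str.{u, u}) where
  sortStructure : ∀ s, cyclicLanguage.Structure (M.carrier s)
  funMap_rot : ∀ (s : cyclicFamilyLanguage.{u}.Srt) (x : M.Tuple (List.get [s])),
    M.funMap (CyclicFamilyFunc.rot s) x = cyclicRot (M := M.carrier s) (x 0)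
  relMap_cyc : ∀ (s : cyclicFamilyLanguage.{u}.Srt) (x : M.Tuple (List.get [s, s, s])),
    M.relMap (CyclicFamilyRel.cyc s) x ↔ CyclicOrd (M := M.carrier s) (x 0) (x 1) (x 2)

attribute [reducible] SortwiseCyclic.sortStructure
attribute [instance] SortwiseCyclic.sortStructure

namespace MSLanguage.Str

/-- The entries of sort `s` of a tuple. -/
def sortVals {L : MSLanguage.{u}} {M : L.Str} {ι : Type v} {σ : ι → L.Srt} (a : M.Tuple σ)
    (s : L.Srt) (i : {i // σ i = s}) : M.carrier s :=
  cast (congrArg M.carrier i.2) (a i.1)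

end MSLanguage.Str

open Str

section Locality

variable {ι : Type v} {σ : ι → cyclicFamilyLanguage.{u}.Srt}

/-- The variables of sort `s` in a context with an additional bound variable: they are the old ones
and possibly the new one. -/
def splitVars {Γ : List cyclicFamilyLanguage.{u}.Srt} (s₀ s : cyclicFamilyLanguage.{u}.Srt) :
    {v : ι ⊕ Fin (s₀ :: Γ).length // Sum.elim σ (s₀ :: Γ).get v = s} →
      {v : ι ⊕ Fin Γ.length // Sum.elim σ Γ.get v = s} ⊕ Unit
  | ⟨.inl i, h⟩ => .inl ⟨.inl i, h⟩
  | ⟨.inr j, h⟩ => Fin.cases (motive := fun j : Fin (Γ.length + 1) => (s₀ :: Γ).get j = s → _)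
      (fun _ => .inr ()) (fun j h => .inl ⟨.inr j, h⟩) j h

/-- The variables of sort `s` are not affected by an additional bound variable of another sort. -/
def dropVars {Γ : List cyclicFamilyLanguage.{u}.Srt} {s₀ s : cyclicFamilyLanguage.{u}.Srt} (h₀ : s₀ ≠ s) :
    {v : ι ⊕ Fin (s₀ :: Γ).length // Sum.elim σ (s₀ :: Γ).get v = s} →
      {v : ι ⊕ Fin Γ.length // Sum.elim σ Γ.get v = s}
  | ⟨.inl i, h⟩ => ⟨.inl i, h⟩
  | ⟨.inr j, h⟩ => Fin.cases (motive := fun j : Fin (Γ.length + 1) => (s₀ :: Γ).get j = s → _)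
      (fun h => absurd h h₀) (fun j h => ⟨.inr j, h⟩) j h

theorem sortVals_consTuple {M : cyclicFamilyLanguage.{u}.Str.{u, u}} {Γ : List cyclicFamilyLanguage.{u}.Srt}
    {s₀ : cyclicFamilyLanguage.{u}.Srt} (a : M.Tuple σ) (b : M.Tuple Γ.get) (x : M.carrier s₀) :
    sortVals (a.append (M.consTuple x b)) s₀ =
      Sum.elim (sortVals (a.append b) s₀) (fun _ => x) ∘ splitVars s₀ s₀ := by
  funext ⟨i, h⟩
  rcases i with i | j
  · rfl
  · induction j using Fin.cases <;> rfl

theorem sortVals_consTuple_of_ne {M : cyclicFamilyLanguage.{u}.Str.{u, u}}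
    {Γ : List cyclicFamilyLanguage.{u}.Srt} {s₀ s : cyclicFamilyLanguage.{u}.Srt} (h₀ : s₀ ≠ s) (a : M.Tuple σ)
    (b : M.Tuple Γ.get) (x : M.carrier s₀) :
    sortVals (a.append (M.consTuple x b)) s = sortVals (a.append b) s ∘ dropVars h₀ := by
  funext ⟨i, h⟩
  rcases i with i | j
  · rfl
  · induction j using Fin.cases with
    | zero => exact absurd h h₀
    | succ j => rfl

/-- The only function symbols are unary and preserve the sort, so a term of sort `s` involves only
variables of sort `s`. -/
theorem exists_term_sortVals {Γ : List cyclicFamilyLanguage.{u}.Srt} {s : cyclicFamilyLanguage.{u}.Srt}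
    (t : Term cyclicFamilyLanguage σ Γ s) :
    ∃ t' : cyclicLanguage.Term {v // Sum.elim σ Γ.get v = s},
      ∀ (M : cyclicFamilyLanguage.{u}.Str.{u, u}) [SortwiseCyclic M] (a : M.Tuple σ)
        (b : M.Tuple Γ.get), t'.realize (sortVals (a.append b) s) = M.termVal a b t := by
  induction t with
  | var i => exact ⟨.var ⟨.inl i, rfl⟩, fun _ _ _ _ => rfl⟩
  | bvar j => exact ⟨.var ⟨.inr j, rfl⟩, fun _ _ _ _ => rfl⟩
  | app f ts ih =>
    cases f with
    | rot s =>
      obtain ⟨t', ht'⟩ := ih 0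
      refine ⟨.func (l := 1) CyclicFunc.rot ![t'], fun M _ a b => ?_⟩
      refine Eq.trans ?_ (SortwiseCyclic.funMap_rot _ fun i => M.termVal a b (ts i)).symm
      refine congrArg (Language.Structure.funMap (L := cyclicLanguage) (M := M.carrier _)
        CyclicFunc.rot) (funext fun i => ?_)
      obtain rfl : i = 0 := Subsingleton.elim _ _
      exact ht' M a b

/-- The formula says that, among the formulas of `Q`, exactly those in `Δ` hold. It lets a
quantifier range over finite approximations of types. -/
theorem exists_formula_iff_mem {α : Type v} {Q : Set (cyclicLanguage.Formula α)} (hQ : Q.Finite)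
    (Δ : Set (cyclicLanguage.Formula α)) :
    ∃ χ : cyclicLanguage.Formula α, ∀ (M : Type u) [cyclicLanguage.Structure M] (x : α → M),
      χ.Realize x ↔ ∀ ψ ∈ Q, (ψ.Realize x ↔ ψ ∈ Δ) := by
  classical
  induction Q, hQ using Set.Finite.induction_on with
  | empty => exact ⟨⊤, fun M _ x => by simp⟩
  | @insert ψ q _ _ ih =>
    obtain ⟨χ, hχ⟩ := ih
    by_cases hψ : ψ ∈ Δ
    · exact ⟨ψ ⊓ χ, fun M _ x => by simp [hχ, hψ]⟩
    · exact ⟨∼ψ ⊓ χ, fun M _ x => by simp [hχ, hψ]⟩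

/-- The formula over a disjoint union is determined by finitely many one-sorted formulas in each
sort. -/
theorem exists_local_formulas {Γ : List cyclicFamilyLanguage.{u}.Srt} (φ : BFormula cyclicFamilyLanguage σ Γ) :
    ∃ Φ : ∀ s, Set (cyclicLanguage.Formula {v // Sum.elim σ Γ.get v = s}), (∀ s, (Φ s).Finite) ∧
      ∀ (M N : cyclicFamilyLanguage.{u}.Str.{u, u}) [SortwiseCyclic M] [SortwiseCyclic N]
        (a : M.Tuple σ) (b : M.Tuple Γ.get) (a' : N.Tuple σ) (b' : N.Tuple Γ.get),
        (∀ s, ∀ ψ ∈ Φ s, ψ.Realize (sortVals (a.append b) s) ↔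
          ψ.Realize (sortVals (a'.append b') s)) →
        (M.BRealize a φ b ↔ N.BRealize a' φ b') := by
  induction φ with
  | falsum => exact ⟨fun _ => ∅, fun _ => Set.finite_empty, fun _ _ _ _ _ _ _ _ _ => Iff.rfl⟩
  | @equal Γ s t₁ t₂ =>
    obtain ⟨t₁', h₁⟩ := exists_term_sortVals t₁
    obtain ⟨t₂', h₂⟩ := exists_term_sortVals t₂
    -- The union over proofs of `s' = s` is a singleton in the sort `s` and empty in all others.
    refine ⟨fun s' => ⋃ h : s' = s, {h ▸ t₁'.equal t₂'},
      fun s' => Set.finite_iUnion fun _ => Set.finite_singleton _, fun M N _ _ a b a' b' h => ?_⟩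
    have := h s (t₁'.equal t₂') (by simp)
    rwa [Language.Formula.realize_equal, Language.Formula.realize_equal, h₁, h₁, h₂, h₂] at this
  | @rel Γ dom R ts =>
    cases R with
    | cyc s₁ =>
      let s : cyclicFamilyLanguage.{u}.Srt := s₁
      choose t' ht' using fun i => exists_term_sortVals (ts i)
      let ψ : cyclicLanguage.Formula {v // Sum.elim σ Γ.get v = s} :=
        Language.Relations.formula (n := 3) CyclicRel.cyc ![t' 0, t' 1, t' 2]
      have hψ : ∀ (M : cyclicFamilyLanguage.{u}.Str.{u, u}) [SortwiseCyclic M] (a : M.Tuple σ)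
          (b : M.Tuple Γ.get), ψ.Realize (sortVals (a.append b) s) ↔
            M.BRealize a (.rel (CyclicFamilyRel.cyc s₁) ts) b := by
        intro M _ a b
        refine Iff.trans (Language.Formula.realize_rel.trans (iff_of_eq (congrArg _ (funext ?_))))
          (SortwiseCyclic.relMap_cyc s fun i => M.termVal a b (ts i)).symm
        intro i
        fin_cases i
        · exact ht' 0 M a b
        · exact ht' 1 M a b
        · exact ht' 2 M a b
      refine ⟨fun s' => ⋃ h : s' = s, {h ▸ ψ},
        fun s' => Set.finite_iUnion fun _ => Set.finite_singleton _,
        fun M N _ _ a b a' b' h => ?_⟩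
      rw [← hψ, ← hψ]
      exact h s ψ (by simp)
  | imp φ ψ ih₁ ih₂ =>
    obtain ⟨Φ, hΦ, h₁⟩ := ih₁
    obtain ⟨Ψ, hΨ, h₂⟩ := ih₂
    exact ⟨fun s => Φ s ∪ Ψ s, fun s => (hΦ s).union (hΨ s), fun M N _ _ a b a' b' h =>
      imp_congr (h₁ M N a b a' b' fun s θ hθ => h s θ (Or.inl hθ))
        (h₂ M N a b a' b' fun s θ hθ => h s θ (Or.inr hθ))⟩
  | @all Γ s₀ φ ih =>
    obtain ⟨Φ, hΦ, hφ⟩ := ih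
    choose χ hχ using fun s => exists_formula_iff_mem.{u} (hΦ s)
    let χ' (s) (Δ : Set _) : cyclicLanguage.Formula {v // Sum.elim σ Γ.get v = s} :=
      Language.Formula.iExs Unit ((χ s Δ).relabel (splitVars s₀ s))
    -- A back-and-forth step: other sorts do not see the new variable, while in the sort `s₀` it is
    -- enough to know which subsets `Δ` of `Φ s₀` are the exact set of formulas satisfied by some
    -- choice of the new element. There are finitely many such `Δ`.
    let Φ' (s) : Set (cyclicLanguage.Formula {v // Sum.elim σ Γ.get v = s}) :=
      (⋃ h : s₀ ≠ s, (fun ψ => ψ.relabel (dropVars h)) '' Φ s) ∪ χ' s '' 𝒫 (Φ s)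
    have step : ∀ (M N : cyclicFamilyLanguage.{u}.Str.{u, u}) [SortwiseCyclic M] [SortwiseCyclic N]
        (a : M.Tuple σ) (b : M.Tuple Γ.get) (a' : N.Tuple σ) (b' : N.Tuple Γ.get),
        (∀ s, ∀ ψ ∈ Φ' s, ψ.Realize (sortVals (a.append b) s) ↔
          ψ.Realize (sortVals (a'.append b') s)) →
        M.BRealize a (.all s₀ φ) b → N.BRealize a' (.all s₀ φ) b' := by
      intro M N _ _ a b a' b' h hM y
      -- `Δ` is the `Φ s₀`-type of the challenge `y`; an element `x` of `M` with the same `Φ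
      -- s₀`-type answers it.
      let Δ := {ψ ∈ Φ s₀ | ψ.Realize (sortVals (a'.append (N.consTuple y b')) s₀)}
      have hχ' : ∀ (K : cyclicFamilyLanguage.{u}.Str.{u, u}) [SortwiseCyclic K] (c : K.Tuple σ)
          (d : K.Tuple Γ.get), (χ' s₀ Δ).Realize (sortVals (c.append d) s₀) ↔
            ∃ x, (χ s₀ Δ).Realize (sortVals (c.append (K.consTuple x d)) s₀) := by
        intro K _ c d
        simp only [χ', Language.Formula.realize_iExs, Language.Formula.realize_relabel,
          sortVals_consTuple]
        exact ⟨fun ⟨i, hi⟩ => ⟨i (), hi⟩, fun ⟨x, hx⟩ => ⟨fun _ => x, hx⟩⟩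
      obtain ⟨x, hx⟩ := (hχ' M a b).1 ((h s₀ _ (Or.inr ⟨Δ, fun ψ hψ => hψ.1, rfl⟩)).2
        ((hχ' N a' b').2 ⟨y, (hχ _ _ _ _).2 fun ψ hψ => ⟨fun h => ⟨hψ, h⟩, fun h => h.2⟩⟩))
      refine (hφ M N a (M.consTuple x b) a' (N.consTuple y b') fun s ψ hψ => ?_).1 (hM x)
      by_cases hs : s₀ = s
      · subst hs
        rw [(hχ _ _ _ _).1 hx ψ hψ]
        exact ⟨fun h => h.2, fun h => ⟨hψ, h⟩⟩
      · have := h s _ (Or.inl (Set.mem_iUnion.2 ⟨hs, ψ, hψ, rfl⟩))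
        simpa only [Language.Formula.realize_relabel, ← sortVals_consTuple_of_ne hs _ _ x,
          ← sortVals_consTuple_of_ne hs _ _ y] using this
    refine ⟨Φ', fun s => (Set.finite_iUnion fun _ => (hΦ s).image _).union
      ((hΦ s).finite_subsets.image _), fun M N _ _ a b a' b' h =>
      ⟨step M N a b a' b' h, step N M a' b' a b fun s ψ hψ => (h s ψ hψ).symm⟩⟩

/-- A disjoint union of elementary embeddings is elementary. -/
theorem realize_sortwise_embedding {M N : cyclicFamilyLanguage.{u}.Str.{u, u}} [SortwiseCyclic M]
    [SortwiseCyclic N] (f : ∀ s, M.carrier s ↪ₑ[cyclicLanguage] N.carrier s)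
    (φ : Formula cyclicFamilyLanguage σ) (a : M.Tuple σ) :
    N.Realize φ (fun i => f (σ i) (a i)) ↔ M.Realize φ a := by
  obtain ⟨Φ, -, hΦ⟩ := exists_local_formulas φ
  refine hΦ N M _ _ _ _ fun s ψ _ => ?_
  rw [← (f s).map_formula]
  refine iff_of_eq (congrArg _ (funext fun ⟨i, h⟩ => ?_))
  rcases i with i | j
  · subst h; rfl
  · exact j.elim0

end Locality

instance cyclicFamily.sortwiseCyclic (P : Type u) [PartialOrder P] :
    SortwiseCyclic (cyclicFamily P) where
  sortStructure s := CyclicPow.structure s.idx P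
  funMap_rot _ _ := rfl
  relMap_cyc _ _ := Iff.rfl

/-- The disjoint union of one-sorted structures. -/
def disjointUnion (G : cyclicFamilyLanguage.{u}.Srt → Type u) [inst : ∀ s, cyclicLanguage.Structure (G s)] :
    cyclicFamilyLanguage.{u}.Str.{u, u} where
  carrier := G
  funMap | .rot s, x => @cyclicRot (G s) (inst s) (x 0)
  relMap | .cyc s, x => @CyclicOrd (G s) (inst s) (x 0) (x 1) (x 2)

instance disjointUnion.sortwiseCyclic (G : cyclicFamilyLanguage.{u}.Srt → Type u)
    [∀ s, cyclicLanguage.Structure (G s)] : SortwiseCyclic (disjointUnion G) where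
  sortStructure s := inferInstanceAs (cyclicLanguage.Structure (G s))
  funMap_rot _ _ := rfl
  relMap_cyc _ _ := Iff.rfl

/-! ## Rotations of linear powers -/

theorem finRotate_val {n : ℕ} (i : Fin n) :
    (finRotate n i : ℕ) = if (i : ℕ) + 1 = n then 0 else (i : ℕ) + 1 := by
  cases n with
  | zero => exact i.elim0
  | succ n =>
    rw [coe_finRotate]
    simp [Fin.ext_iff]

/-- The cyclic order of a lexicographic order is invariant under the rotation of the first
coordinate, which is here a natural number less than `N`. -/
theorem cyclic_lex_rotate {N a b c a' b' c' : ℕ} {u v w : Prop} (ha : a < N) (hb : b < N)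
    (hc : c < N) (ha' : a' = if a + 1 = N then 0 else a + 1)
    (hb' : b' = if b + 1 = N then 0 else b + 1) (hc' : c' = if c + 1 = N then 0 else c + 1) :
    ((a' < b' ∨ a' = b' ∧ u) ∧ (b' < c' ∨ b' = c' ∧ v) ∨
      (b' < c' ∨ b' = c' ∧ v) ∧ (c' < a' ∨ c' = a' ∧ w) ∨
      (c' < a' ∨ c' = a' ∧ w) ∧ (a' < b' ∨ a' = b' ∧ u)) ↔
    ((a < b ∨ a = b ∧ u) ∧ (b < c ∨ b = c ∧ v) ∨
      (b < c ∨ b = c ∧ v) ∧ (c < a ∨ c = a ∧ w) ∨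
      (c < a ∨ c = a ∧ w) ∧ (a < b ∨ a = b ∧ u)) := by
  -- Once wrap-around and the truth values of `u`, `v`, `w` are fixed, only linear arithmetic is
  -- left.
  split_ifs at ha' hb' hc' <;> by_cases hu : u <;> by_cases hv : v <;> by_cases hw : w <;>
    simp only [hu, hv, hw, and_true, and_false, or_false] <;> omega

namespace CyclicPow

variable {n : ℕ+} {P : Type u} {k : ℕ}

/-- The index of the copy containing an element. -/
def idx (x : CyclicPow n P) : Fin n := (ofLex x).1

/-- The element of `P` corresponding to an element of a copy of `P`. -/
def pt (x : CyclicPow n P) : P := (ofLex x).2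

@[simp] theorem rot_mk (p : P) (i : Fin n) : rot (mk p i) = mk p (finRotate n i) := rfl

theorem lt_iff [PartialOrder P] {x y : CyclicPow n P} :
    lt x y ↔ (x.idx : ℕ) < y.idx ∨ (x.idx : ℕ) = y.idx ∧ x.pt < y.pt := by
  rw [← Fin.lt_def, ← Fin.ext_iff]
  exact Prod.Lex.lt_iff

/-- The position of an element of a power of `k` copies of `P`, that is, the index of the copy of
`P`. -/
def pos (x : CyclicPow n (LinPow k P)) : ℕ := x.idx * k + (ofLex x.pt).1

theorem pos_lt (x : CyclicPow n (LinPow k P)) : x.pos < n * k := by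
  have h₁ := x.idx.2
  have h₂ := (ofLex x.pt).1.2
  calc x.pos < x.idx * k + k := by unfold pos; omega
    _ = (x.idx + 1) * k := by ring
    _ ≤ n * k := Nat.mul_le_mul_right k h₁

/-- The linear sum of `n` copies of a sum of `k` copies of `P` is a linear sum of `n * k` copies of
`P`, with position as the outer coordinate. -/
theorem lt_iff_pos [PartialOrder P] {x y : CyclicPow n (LinPow k P)} :
    lt x y ↔ x.pos < y.pos ∨ x.pos = y.pos ∧ (ofLex x.pt).2 < (ofLex y.pt).2 := by
  rw [lt_iff, Prod.Lex.lt_iff, Fin.lt_def, Fin.ext_iff]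
  have h₁ := (ofLex x.pt).1.2
  have h₂ := (ofLex y.pt).1.2
  unfold pos
  rcases lt_trichotomy (x.idx : ℕ) y.idx with h | h | h
  · have := Nat.mul_le_mul_right k h
    have h3 : x.idx * k + (ofLex x.pt).1 < y.idx * k + (ofLex y.pt).1 := by
      rw [Nat.succ_mul] at this; omega
    exact iff_of_true (Or.inl h) (Or.inl h3)
  · simp [h]
  · have := Nat.mul_le_mul_right k h
    have h3 : y.idx * k + (ofLex y.pt).1 < x.idx * k + (ofLex x.pt).1 := by
      rw [Nat.succ_mul] at this; omega
    refine iff_of_false (fun h' => ?_) (fun h' => ?_)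
    · rcases h' with h' | h' <;> omega
    · rcases h' with h' | h' <;> omega

/-- The shift of every copy of `P` to the next one. -/
def shift (n : ℕ+) (k : ℕ) (P : Type u) :
    CyclicPow n (LinPow k P) ≃ CyclicPow n (LinPow k P) where
  toFun x := mk (toLex (finRotate k (ofLex x.pt).1, (ofLex x.pt).2))
    (if ((ofLex x.pt).1 : ℕ) + 1 = k then finRotate n x.idx else x.idx)
  invFun x := mk (toLex ((finRotate k).symm (ofLex x.pt).1, (ofLex x.pt).2))
    (if ((ofLex x.pt).1 : ℕ) = 0 then (finRotate n).symm x.idx else x.idx)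
  left_inv x := by
    have := finRotate_val (ofLex x.pt).1
    change mk (toLex ((finRotate k).symm (finRotate k (ofLex x.pt).1), (ofLex x.pt).2))
      (if (finRotate k (ofLex x.pt).1 : ℕ) = 0 then (finRotate n).symm
        (if ((ofLex x.pt).1 : ℕ) + 1 = k then finRotate n x.idx else x.idx)
        else (if ((ofLex x.pt).1 : ℕ) + 1 = k then finRotate n x.idx else x.idx)) = x
    rw [Equiv.symm_apply_apply, this]
    by_cases h : ((ofLex x.pt).1 : ℕ) + 1 = k
    · rw [if_pos h, if_pos rfl, if_pos h, Equiv.symm_apply_apply]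
      rfl
    · rw [if_neg h, if_neg h, if_neg (by omega)]
      rfl
  right_inv x := by
    have := finRotate_val ((finRotate k).symm (ofLex x.pt).1)
    change mk (toLex (finRotate k ((finRotate k).symm (ofLex x.pt).1), (ofLex x.pt).2))
      (if ((finRotate k).symm (ofLex x.pt).1 : ℕ) + 1 = k then finRotate n
        (if ((ofLex x.pt).1 : ℕ) = 0 then (finRotate n).symm x.idx else x.idx)
        else (if ((ofLex x.pt).1 : ℕ) = 0 then (finRotate n).symm x.idx else x.idx)) = x
    rw [Equiv.apply_symm_apply] at this ⊢
    by_cases h : (((finRotate k).symm (ofLex x.pt).1 : Fin k) : ℕ) + 1 = k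
    · rw [if_pos h] at this
      rw [if_pos h, if_pos this, Equiv.apply_symm_apply]
      rfl
    · rw [if_neg h] at this
      rw [if_neg h, if_neg (by omega)]
      rfl

theorem shift_mk (p : P) (j : Fin k) (i : Fin n) :
    shift n k P (mk (toLex (j, p)) i) =
      mk (toLex (finRotate k j, p)) (if (j : ℕ) + 1 = k then finRotate n i else i) :=
  rfl

theorem pos_shift (x : CyclicPow n (LinPow k P)) :
    (shift n k P x).pos = if x.pos + 1 = n * k then 0 else x.pos + 1 := by
  obtain ⟨i, j, p, rfl⟩ : ∃ i j p, x = mk (toLex (j, p)) i := ⟨_, _, _, rfl⟩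
  have hpos : (mk (toLex (j, p)) i : CyclicPow n (LinPow k P)).pos = i * k + j := rfl
  have hlt := pos_lt (mk (toLex (j, p)) i : CyclicPow n (LinPow k P))
  have hshift : (shift n k P (mk (toLex (j, p)) i)).pos =
      (if (j : ℕ) + 1 = k then finRotate n i else i : Fin n) * k + finRotate k j := rfl
  rw [hpos] at hlt
  rw [hshift, hpos, finRotate_val j]
  by_cases hj : (j : ℕ) + 1 = k
  · rw [if_pos hj, if_pos hj, finRotate_val i]
    by_cases hi : (i : ℕ) + 1 = n
    · rw [if_pos hi, if_pos]
      · simp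
      · rw [add_assoc, hj, ← Nat.succ_mul]
        exact congrArg (· * k) hi
    · rw [if_neg hi, if_neg]
      · rw [add_mul, one_mul, add_assoc, add_assoc, hj, add_zero]
      · rw [add_assoc, hj, ← Nat.succ_mul]
        exact fun h => hi (Nat.eq_of_mul_eq_mul_right (by omega) h)
  · rw [if_neg hj, if_neg hj, if_neg, add_assoc]
    intro h
    have h₁ := Nat.mul_le_mul_right k i.2
    rw [Nat.succ_mul] at h₁
    omega

/-- In terms of positions the shift is the rotation of the `n * k` copies of `P`, and rotating the
outer coordinate preserves the cyclic order. -/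
theorem C_shift [PartialOrder P] (x y z : CyclicPow n (LinPow k P)) :
    C (shift n k P x) (shift n k P y) (shift n k P z) ↔ C x y z := by
  simp only [C, lt_iff_pos]
  exact cyclic_lex_rotate (pos_lt x) (pos_lt y) (pos_lt z) (pos_shift _) (pos_shift _)
    (pos_shift _)

theorem shift_rot (x : CyclicPow n (LinPow k P)) :
    shift n k P (rot x) = rot (shift n k P x) := by
  obtain ⟨i, j, p, rfl⟩ : ∃ i j p, x = mk (toLex (j, p)) i := ⟨_, _, _, rfl⟩
  simp only [rot_mk, shift_mk]
  split_ifs <;> rfl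

/-- The shift is an automorphism. -/
def shiftEquiv (n : ℕ+) (k : ℕ) (P : Type u) [PartialOrder P] :
    CyclicPow n (LinPow k P) ≃[cyclicLanguage] CyclicPow n (LinPow k P) where
  toEquiv := shift n k P
  map_fun' {m} f x := by
    cases f
    exact shift_rot _
  map_rel' {m} r x := by
    cases r
    exact C_shift _ _ _

/-- Iterates of an elementary self-embedding. -/
def _root_.FirstOrder.Language.ElementaryEmbedding.iter {L : FirstOrder.Language.{v, w}} {M : Type u}
    [L.Structure M] (f : M ↪ₑ[L] M) : ℕ → (M ↪ₑ[L] M)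
  | 0 => .refl L M
  | t + 1 => (f.iter t).comp f

/-- `G 0` puts the two copies of each pair in places 0 and 2 of the triple, `H 0` in places 1 and 2,
and `E 0` uses place 2; index `t` adds `t` shifts. As `G t` and `H t` are elementary and agree on
the second copies, the images of `x` under them, namely `G t x` and `G (t + 1) x`, have the same
type over the image of `E t`. -/
theorem exists_elementaryEmbedding_sequences [PartialOrder P] (hP : CyclicallyThreeSplitting P)
    [Nonempty P] (n : ℕ+) :
    ∃ (G H : ℕ → CyclicPow n (LinPow 2 P) ↪ₑ[cyclicLanguage] CyclicPow n (LinPow 3 P))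
      (E : ℕ → CyclicPow n P ↪ₑ[cyclicLanguage] CyclicPow n (LinPow 3 P))
      (c : CyclicPow n P → CyclicPow n (LinPow 2 P)) (x : CyclicPow n (LinPow 2 P)),
      (∀ t y, G t (c y) = E t y) ∧ (∀ t y, H t (c y) = E t y) ∧ (∀ t, H t x = G (t + 1) x) ∧
        ∀ t, G (t + 3) x = rot (G t x) := by
  obtain ⟨⟨f₁, hf₁⟩, f₂, hf₂⟩ := hP n
  let S : CyclicPow n (LinPow 3 P) ↪ₑ[cyclicLanguage] CyclicPow n (LinPow 3 P) :=
    (shiftEquiv n 3 P).toElementaryEmbedding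
  let S' : CyclicPow n (LinPow 2 P) ↪ₑ[cyclicLanguage] CyclicPow n (LinPow 2 P) :=
    (shiftEquiv n 2 P).symm.toElementaryEmbedding
  have hS' : ∀ (p : P) (j : Fin 2) (i : Fin n), S' (mk (toLex (j, p)) i) =
      mk (toLex ((finRotate 2).symm j, p)) (if (j : ℕ) = 0 then (finRotate n).symm i else i) :=
    fun p j i => rfl
  have hrot : ∀ x, S (S (S x)) = rot x := by
    intro x
    obtain ⟨i, j, p, rfl⟩ : ∃ i j p, x = mk (toLex (j, p)) i := ⟨_, _, _, rfl⟩
    fin_cases j <;> rfl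
  have hrotS : ∀ t x, S.iter t (rot x) = rot (S.iter t x) := by
    intro t
    induction t with
    | zero => exact fun x => rfl
    | succ t ih => exact fun x => (congrArg (S.iter t) (shift_rot x)).trans (ih _)
  -- The backward shift `S'` makes each second copy the first of its pair and sends each first copy
  -- to the previous pair; after `f₂`, two shifts bring these to places 2 and 0 of the original
  -- triple.
  let g := S.comp (S.comp (f₂.comp S'))
  let h := S.comp f₂
  let e := S.comp (S.comp f₁)
  have h20 : (finRotate 2).symm 0 = 1 := by decide
  have h21 : (finRotate 2).symm 1 = 0 := by decide
  have hg₀ : ∀ (p : P) (i : Fin n), g (mk (toLex (0, p)) i) = mk (toLex (0, p)) i := by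
    intro p i
    change S (S (f₂ (S' (mk (toLex (0, p)) i)))) = _
    rw [hS', h20, hf₂]
    change mk _ (finRotate n ((finRotate n).symm i)) = _
    rw [Equiv.apply_symm_apply]
    rfl
  have hg₁ : ∀ (p : P) (i : Fin n), g (mk (toLex (1, p)) i) = mk (toLex (2, p)) i := by
    intro p i
    change S (S (f₂ (S' (mk (toLex (1, p)) i)))) = _
    rw [hS', h21, hf₂]
    rfl
  have hh₀ : ∀ (p : P) (i : Fin n), h (mk (toLex (0, p)) i) = mk (toLex (1, p)) i := by
    intro p i
    change S (f₂ (mk (toLex (0, p)) i)) = _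
    rw [hf₂]
    rfl
  have hh₁ : ∀ (p : P) (i : Fin n), h (mk (toLex (1, p)) i) = mk (toLex (2, p)) i := by
    intro p i
    change S (f₂ (mk (toLex (1, p)) i)) = _
    rw [hf₂]
    rfl
  have he : ∀ y, e y = mk (toLex (2, y.pt)) y.idx := by
    intro y
    change S (S (f₁ (mk y.pt y.idx))) = _
    rw [hf₁]
    rfl
  refine ⟨fun t => (S.iter t).comp g, fun t => (S.iter t).comp h, fun t => (S.iter t).comp e,
    fun y => mk (toLex (1, y.pt)) y.idx, mk (toLex (0, Classical.arbitrary P)) ⟨0, n.pos⟩,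
    fun t y => ?_, fun t y => ?_, fun t => ?_, fun t => ?_⟩
  · exact congrArg (S.iter t) ((hg₁ _ _).trans (he y).symm)
  · exact congrArg (S.iter t) ((hh₁ _ _).trans (he y).symm)
  · refine congrArg (S.iter t) ((hh₀ _ _).trans ?_)
    rw [hg₀]
    rfl
  · change S.iter t (S (S (S (g _)))) = rot (S.iter t (g _))
    rw [hrot, hrotS]

end CyclicPow

/-! ## The symbols of the language of `(C_n(P))_n` -/

section Symbols

variable {ι : Type v} {σ : ι → cyclicFamilyLanguage.{u}.Srt}
  {Γ : List cyclicFamilyLanguage.{u}.Srt} {s : cyclicFamilyLanguage.{u}.Srt}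
  {M : cyclicFamilyLanguage.{u}.Str.{u, u}}

/-- The rotation of the sort `s` of a structure. -/
def rotVal (x : M.carrier s) : M.carrier s :=
  M.funMap (CyclicFamilyFunc.rot s) (M.consTuple x M.nilTuple)

/-- The ternary relation on the sort `s` of a structure. -/
def CycVal (x y z : M.carrier s) : Prop :=
  M.relMap (CyclicFamilyRel.cyc s) (M.consTuple x (M.consTuple y (M.consTuple z M.nilTuple)))

/-- The term for the rotation. -/
def rotTerm (t : Term cyclicFamilyLanguage σ Γ s) : Term cyclicFamilyLanguage σ Γ s :=
  .app (CyclicFamilyFunc.rot s) (Fin.cases (motive := fun i : Fin 1 => Term _ σ Γ ([s].get i)) t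
    fun i => i.elim0)

/-- The formula for the ternary relation. -/
def cycFormula (t₁ t₂ t₃ : Term cyclicFamilyLanguage σ Γ s) : BFormula cyclicFamilyLanguage σ Γ :=
  .rel (CyclicFamilyRel.cyc s) (Fin.cases (motive := fun i : Fin 3 => Term _ σ Γ ([s, s, s].get i))
    t₁ (Fin.cases (motive := fun i : Fin 2 => Term _ σ Γ ([s, s].get i)) t₂
    (Fin.cases (motive := fun i : Fin 1 => Term _ σ Γ ([s].get i)) t₃ fun i => i.elim0)))

@[simp]
theorem termVal_rotTerm (a : M.Tuple σ) (b : M.Tuple Γ.get)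
    (t : Term cyclicFamilyLanguage σ Γ s) :
    M.termVal a b (rotTerm t) = rotVal (M.termVal a b t) := by
  refine congrArg (M.funMap (CyclicFamilyFunc.rot s)) (funext fun i => ?_)
  induction i using Fin.cases with
  | zero => rfl
  | succ i => exact i.elim0

@[simp]
theorem termVal_rotTerm_iterate (a : M.Tuple σ) (b : M.Tuple Γ.get)
    (t : Term cyclicFamilyLanguage σ Γ s) (k : ℕ) :
    M.termVal a b (rotTerm^[k] t) = rotVal^[k] (M.termVal a b t) := by
  induction k with
  | zero => rfl
  | succ k ih => simp only [Function.iterate_succ_apply', termVal_rotTerm, ih]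

@[simp]
theorem bRealize_cycFormula (a : M.Tuple σ) (b : M.Tuple Γ.get)
    (t₁ t₂ t₃ : Term cyclicFamilyLanguage σ Γ s) :
    M.BRealize a (cycFormula t₁ t₂ t₃) b ↔
      CycVal (M.termVal a b t₁) (M.termVal a b t₂) (M.termVal a b t₃) := by
  refine iff_of_eq (congrArg (M.relMap (CyclicFamilyRel.cyc s)) (funext fun i => ?_))
  induction i using Fin.cases with
  | zero => rfl
  | succ i =>
    induction i using Fin.cases with
    | zero => rfl
    | succ i =>
      induction i using Fin.cases with
      | zero => rfl
      | succ i => exact i.elim0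

end Symbols

theorem MSLanguage.Str.realize_equal {L : MSLanguage.{u}} {M : L.Str} {ι : Type v} {σ : ι → L.Srt}
    {s : L.Srt} (t₁ t₂ : Term L σ [] s) (a : M.Tuple σ) :
    M.Realize (.equal t₁ t₂) a ↔ M.termVal a M.nilTuple t₁ = M.termVal a M.nilTuple t₂ :=
  Iff.rfl

/-! ## Sequences of adjacent tuples in a monster model -/

/-- Renaming variables turns a formula about selected entries into one about the whole tuple, over
the same model. -/
theorem MSLanguage.Str.LascarAdj.comp {L : MSLanguage.{u}} {M : L.Str.{u, u}}
    {X Y : M.Tuple fun s : L.Srt => s} (h : M.LascarAdj X Y) {ι : Type v} (σ : ι → L.Srt) :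
    M.LascarAdj (fun i => X (σ i)) (fun i => Y (σ i)) := by
  obtain ⟨N, f, h⟩ := h
  refine ⟨N, f, fun φ => ?_⟩
  have key := h (Formula.rename φ (σ' := Sum.elim (fun s : L.Srt => s)
    fun x : (Σ s, N.carrier s) => x.1) fun
    | .inl i => .var (σ := Sum.elim (fun s : L.Srt => s) fun x : (Σ s, N.carrier s) => x.1)
        (.inl (σ i))
    | .inr x => .var (σ := Sum.elim (fun s : L.Srt => s) fun x : (Σ s, N.carrier s) => x.1)
        (.inr x))
  rw [realize_rename, realize_rename] at key
  convert key using 2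
  all_goals
    funext i
    rcases i with i | x <;> rfl

/-- The models over which types are compared must be small, and of the bound `κ` only uncountability
is used. -/
theorem exists_countable_elementarySubstructure (M : Type u) [cyclicLanguage.Structure M] :
    ∃ S : cyclicLanguage.ElementarySubstructure M, Countable S := by
  have h (l : ℕ) : Countable (cyclicLanguage.Functions l) :=
    @Finite.to_countable _ (@Finite.of_subsingleton (CyclicFunc l) ⟨by rintro ⟨⟩ ⟨⟩; rfl⟩)
  have h' (l : ℕ) : Countable (cyclicLanguage.Relations l) :=
    @Finite.to_countable _ (@Finite.of_subsingleton (CyclicRel l) ⟨by rintro ⟨⟩ ⟨⟩; rfl⟩)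
  have hL : cyclicLanguage.card ≤ ℵ₀ :=
    have : Countable cyclicLanguage.Symbols := instCountableSum
    Cardinal.mk_le_aleph0
  by_cases hM : ℵ₀ ≤ #M
  · obtain ⟨S, -, hS⟩ := Language.exists_elementarySubstructure_card_eq cyclicLanguage (M := M) ∅
      (ℵ₀ : Cardinal.{u}) le_rfl (by simp) (by simpa using hL) (by simpa using hM)
    exact ⟨S, Cardinal.mk_le_aleph0_iff.1 (by simpa using hS.le)⟩
  · have : Countable M := Cardinal.mk_le_aleph0_iff.1 (not_le.1 hM).le
    exact ⟨⊤, inferInstance⟩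

theorem realize_sentence_sortwise {M N : cyclicFamilyLanguage.{u}.Str.{u, u}} [SortwiseCyclic M]
    [SortwiseCyclic N] (f : ∀ s, M.carrier s ↪ₑ[cyclicLanguage] N.carrier s)
    (φ : Sentence cyclicFamilyLanguage) :
    N.Realize φ (fun i => i.elim) ↔ M.Realize φ (fun i => i.elim) := by
  rw [← realize_sortwise_embedding f]
  exact iff_of_eq (congrArg _ (funext fun i => i.elim))

theorem exists_lascarAdj_sequence {P : Type u} [PartialOrder P] [Nonempty P]
    (hP : WeaklyCyclicallyThreeSplitting P) {κ : Cardinal.{u}}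
    {C : cyclicFamilyLanguage.{u}.Str.{u, u}} (hC : C.IsMonster κ)
    (hT : C.Models (cyclicFamily P).theory) :
    ∃ X : ℕ → C.Tuple fun s : cyclicFamilyLanguage.{u}.Srt => s,
      (∀ t, C.LascarAdj (X t) (X (t + 1))) ∧ ∀ t s, X (t + 3) s = rotVal (X t s) := by
  obtain ⟨Q, _, hQ, hPQ⟩ := hP
  have : Nonempty Q := ⟨((hPQ 1).some (CyclicPow.mk (Classical.arbitrary P) 0)).pt⟩
  choose G H E c x hG hH hGH hrot using
    fun s : cyclicFamilyLanguage.{u}.Srt =>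
      CyclicPow.exists_elementaryEmbedding_sequences hQ (CyclicSort.idx s)
  choose S hS using fun s : cyclicFamilyLanguage.{u}.Srt =>
    exists_countable_elementarySubstructure (CyclicPow (CyclicSort.idx s) Q)
  let K := cyclicFamily (LinPow 2 Q)
  let F := cyclicFamily (LinPow 3 Q)
  let N := disjointUnion fun s => S s
  -- The theories agree since $C_n(P)\cong C_n(Q)\preceq C_n(Q^{\oplus 3})$ in each sort.
  have hF : C.Models F.theory := by
    intro φ hφ
    refine hT ?_
    have h₁ := realize_sentence_sortwise (M := cyclicFamily Q) (N := F) (fun s => E s 0) φ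
    have h₂ := realize_sentence_sortwise (M := cyclicFamily P) (N := cyclicFamily Q)
      (fun s => (hPQ (CyclicSort.idx s)).some.toElementaryEmbedding) φ
    exact h₂.1 (h₁.1 hφ)
  -- One countable tuple lists all points of the sequence in all sorts, together with the images
  -- under each `E s t` of the countable submodels.
  let ι := (ℕ × cyclicFamilyLanguage.{u}.Srt) ⊕ (ℕ × Σ s, N.carrier s)
  let σ : ι → cyclicFamilyLanguage.{u}.Srt := Sum.elim Prod.snd fun y => y.2.1
  let a : F.Tuple σ
    | .inl (t, s) => G s t (x s)
    | .inr (t, y) => E y.1 t (y.2 : S y.1).1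
  have : Countable cyclicFamilyLanguage.{u}.Srt :=
    Function.Injective.countable (f := CyclicSort.idx) fun ⟨_⟩ ⟨_⟩ h => congrArg _ h
  have hN (s : cyclicFamilyLanguage.{u}.Srt) : Countable (N.carrier s) := hS s
  obtain ⟨b, hb⟩ := hC.saturated.exists_realize_iff hF (ι := ι) (σ := σ)
    (Cardinal.mk_le_aleph0.trans_lt ((le_max_left _ _).trans_lt hC.lt)) a
  have hb' : ∀ {ι' : Type u} {σ' : ι' → cyclicFamilyLanguage.{u}.Srt}
      (φ : Formula cyclicFamilyLanguage σ') (θ : ∀ i, Term cyclicFamilyLanguage σ [] (σ' i)),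
      C.Realize φ (fun i => C.termVal b C.nilTuple (θ i)) ↔
        F.Realize φ (fun i => F.termVal a F.nilTuple (θ i)) := by
    intro ι' σ' φ θ
    rw [← realize_rename, ← realize_rename, hb]
  let f (t : ℕ) : N.ElemEmb C :=
    { toFun := fun s y => b (.inr (t, ⟨s, y⟩))
      realize_iff := fun {ι' σ'} φ d => by
        refine (hb' φ fun i => .var (σ := σ) (.inr (t, ⟨σ' i, d i⟩))).trans ?_
        exact realize_sortwise_embedding (M := N) (N := F)
          (fun s => (E s t).comp (S s).subtype) φ d }
  refine ⟨fun t s => b (.inl (t, s)), fun t => ⟨N, f t, fun φ => ?_⟩, fun t s => ?_⟩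
  · let τ : cyclicFamilyLanguage.{u}.Srt ⊕ (Σ s, N.carrier s) → cyclicFamilyLanguage.{u}.Srt :=
      Sum.elim (fun s => s) fun y => y.1
    let θ (t' : ℕ) : ∀ i, Term cyclicFamilyLanguage σ [] (τ i)
      | .inl s => .var (σ := σ) (.inl (t', s))
      | .inr y => .var (σ := σ) (.inr (t, y))
    let d : K.Tuple τ
      | .inl s => x s
      | .inr y => c y.1 (y.2 : S y.1).1
    have h₁ := realize_sortwise_embedding (M := K) (N := F) (fun s => G s t) φ d
    have h₂ := realize_sortwise_embedding (M := K) (N := F) (fun s => H s t) φ d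
    have e₁ : (fun i => F.termVal a F.nilTuple (θ t i)) = fun i => G (τ i) t (d i) := by
      funext i
      rcases i with s | y
      · rfl
      · exact (hG _ _ _).symm
    have e₂ : (fun i => F.termVal a F.nilTuple (θ (t + 1) i)) = fun i => H (τ i) t (d i) := by
      funext i
      rcases i with s | y
      · exact (hGH _ _).symm
      · exact (hH _ _ _).symm
    have k₁ := hb' φ (θ t)
    have k₂ := hb' φ (θ (t + 1))
    rw [e₁] at k₁
    rw [e₂] at k₂
    have key := k₁.trans (h₁.trans (h₂.symm.trans k₂.symm))
    convert key using 2
    all_goals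
      funext i
      rcases i with i | y <;> rfl
  · let y (t : ℕ) : Term cyclicFamilyLanguage σ [] s := .var (σ := σ) (.inl (t, s))
    have h₁ : F.termVal a F.nilTuple (y (t + 3)) = F.termVal a F.nilTuple (rotTerm (y t)) :=
      (hrot s t).trans (termVal_rotTerm a F.nilTuple (y t)).symm
    have h₂ : C.termVal b C.nilTuple (y (t + 3)) = C.termVal b C.nilTuple (rotTerm (y t)) :=
      (realize_equal _ _ _).1 ((hb _).2 ((realize_equal _ _ _).2 h₁))
    exact h₂.trans (termVal_rotTerm b C.nilTuple (y t))

/-! ## Lower bounds for the Lascar distance -/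

section Near

variable {ι : Type v} {σ : ι → cyclicFamilyLanguage.{u}.Srt}
  {Γ : List cyclicFamilyLanguage.{u}.Srt} {s : cyclicFamilyLanguage.{u}.Srt}
  {M : cyclicFamilyLanguage.{u}.Str.{u, u}}

/-- Two elements are near if they are on a common arc of length two. -/
def Near (x y : M.carrier s) : Prop :=
  ∃ e : M.carrier s, CycVal e x (rotVal (rotVal e)) ∧ CycVal e y (rotVal (rotVal e))

/-- There is a chain of near elements of the given length. -/
def NearChain : ℕ → M.carrier s → M.carrier s → Prop
  | 0, x, y => x = y
  | j + 1, x, y => ∃ z, Near x z ∧ NearChain j z y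

/-- The formula expressing that there is a chain of near elements of the given length. -/
def nearChainFormula : ℕ → ∀ {Γ : List cyclicFamilyLanguage.{u}.Srt},
    Term cyclicFamilyLanguage σ Γ s → Term cyclicFamilyLanguage σ Γ s →
      BFormula cyclicFamilyLanguage σ Γ
  | 0, _, t, t' => .equal t t'
  | j + 1, _, t, t' => .ex s (.conj (.ex s (.conj
      (cycFormula .bvarZero ((t.lift s).lift s) (rotTerm (rotTerm .bvarZero)))
      (cycFormula .bvarZero (Term.bvarZero.lift s) (rotTerm (rotTerm .bvarZero)))))
      (nearChainFormula j .bvarZero (t'.lift s)))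

theorem bRealize_nearChainFormula (j : ℕ) {Γ : List cyclicFamilyLanguage.{u}.Srt}
    (t t' : Term cyclicFamilyLanguage σ Γ s) (a : M.Tuple σ) (b : M.Tuple Γ.get) :
    M.BRealize a (nearChainFormula j t t') b ↔
      NearChain j (M.termVal a b t) (M.termVal a b t') := by
  induction j generalizing Γ with
  | zero => rfl
  | succ j ih => simp [nearChainFormula, NearChain, Near, ih]

/-- The formula expressing that `t'` is not on any of the first `k` arcs of length two starting at
the rotations of `t`. -/
def noArcFormula (t t' : Term cyclicFamilyLanguage σ Γ s) : ℕ → BFormula cyclicFamilyLanguage σ Γ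
  | 0 => .imp .falsum .falsum
  | k + 1 => .conj (noArcFormula t t' k)
      (.neg (cycFormula (rotTerm^[k] t) t' (rotTerm^[k + 2] t)))

theorem bRealize_noArcFormula (t t' : Term cyclicFamilyLanguage σ Γ s) (k : ℕ) (a : M.Tuple σ)
    (b : M.Tuple Γ.get) :
    M.BRealize a (noArcFormula t t' k) b ↔ ∀ l < k, ¬ CycVal (rotVal^[l] (M.termVal a b t))
      (M.termVal a b t') (rotVal^[l + 2] (M.termVal a b t)) := by
  induction k with
  | zero => simp [noArcFormula, BRealize]
  | succ k ih =>
    simp only [noArcFormula, bRealize_conj, ih, bRealize_neg, bRealize_cycFormula,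
      termVal_rotTerm_iterate, Nat.lt_succ_iff_lt_or_eq, or_imp, forall_and, forall_eq]

end Near

/-! ### Displacement of the index of a copy along arcs and chains -/

namespace CyclicPow

variable {n : ℕ+} {P : Type u}

theorem idx_rot (x : CyclicPow n P) :
    ((rot x).idx : ℕ) = if (x.idx : ℕ) + 1 = n then 0 else (x.idx : ℕ) + 1 :=
  finRotate_val _

theorem idx_rot_iterate (x : CyclicPow n P) (k : ℕ) :
    ((rot^[k] x).idx : ℤ) ≡ x.idx + k [ZMOD n] := by
  induction k with
  | zero => simp
  | succ k ih =>
    rw [Function.iterate_succ_apply']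
    refine Int.ModEq.trans ?_ (ih.add_right 1) |>.trans (by push_cast; rw [add_assoc])
    rw [idx_rot]
    split_ifs with h
    · have : (((rot^[k] x).idx : ℕ) : ℤ) + 1 = n := by exact_mod_cast h
      rw [this]
      exact (Int.modEq_zero_iff_dvd.2 dvd_rfl).symm
    · push_cast
      rfl

theorem exists_rot_iterate_idx_eq (x : CyclicPow n P) {i : ℕ} (hi : i < n) :
    ∃ k < (n : ℕ), ((rot^[k] x).idx : ℕ) = i := by
  have hx := x.idx.2
  have key : ∀ k : ℕ, ((rot^[k] x).idx : ℤ) = ((x.idx : ℕ) + k : ℤ) % n := fun k => by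
    rw [← idx_rot_iterate x k]
    exact (Int.emod_eq_of_lt (by positivity) (by exact_mod_cast (rot^[k] x).idx.2)).symm
  by_cases h : (x.idx : ℕ) ≤ i
  · refine ⟨i - x.idx, by omega, ?_⟩
    have := key (i - x.idx)
    rw [Nat.cast_sub h, add_sub_cancel, Int.emod_eq_of_lt (by positivity) (by exact_mod_cast hi)]
      at this
    exact_mod_cast this
  · refine ⟨i + n - x.idx, by omega, ?_⟩
    have := key (i + n - x.idx)
    rw [Nat.cast_sub (by omega), add_sub_cancel, Nat.cast_add, Int.add_emod_right,
      Int.emod_eq_of_lt (by positivity) (by exact_mod_cast hi)] at this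
    exact_mod_cast this

variable [PartialOrder P]

theorem exists_C_rot (hn : 3 ≤ (n : ℕ)) (e x : CyclicPow n P) :
    ∃ k < (n : ℕ), C (rot^[k] e) x (rot^[k + 2] e) := by
  have hx := x.idx.2
  -- Rotate `e` into the copy just before that of `x`; two further rotations lead to the copy just
  -- after it. These three copies are distinct because `n ≥ 3`.
  obtain ⟨k, hk, hke⟩ := exists_rot_iterate_idx_eq e
    (i := if (x.idx : ℕ) = 0 then n - 1 else x.idx - 1) (by split_ifs <;> omega)
  refine ⟨k, hk, ?_⟩
  rw [Function.iterate_succ_apply', Function.iterate_succ_apply']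
  generalize rot^[k] e = y at hke
  have h₁ := idx_rot y
  have h₂ := idx_rot (rot y)
  simp only [C, lt_iff]
  split_ifs at hke h₁ h₂ <;> omega

theorem idx_of_C_rot (hn : 3 ≤ (n : ℕ)) {e x : CyclicPow n P} (h : C e x (rot (rot e))) :
    ∃ r : ℤ, 0 ≤ r ∧ r ≤ 2 ∧ (x.idx : ℤ) ≡ e.idx + r [ZMOD n] := by
  have hx := x.idx.2
  have he := e.idx.2
  have h₁ := idx_rot e
  have h₂ := idx_rot (rot e)
  -- The second case is an arc that passes the end of the last copy.
  have : ((e.idx : ℕ) ≤ x.idx ∧ (x.idx : ℕ) ≤ e.idx + 2) ∨ (x.idx : ℕ) + n ≤ e.idx + 2 := by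
    simp only [C, lt_iff] at h
    split_ifs at h₁ h₂ <;> omega
  rcases this with h | h
  · exact ⟨x.idx - e.idx, by omega, by omega, by rw [add_sub_cancel]⟩
  · exact ⟨x.idx + n - e.idx, by omega, by omega, by
      rw [add_sub_cancel]; exact Int.ModEq.symm (by simp [Int.ModEq])⟩

theorem idx_of_nearChain {s : cyclicFamilyLanguage.{u}.Srt} (hn : 3 ≤ (CyclicSort.idx s : ℕ))
    (j : ℕ) (x y : CyclicPow (CyclicSort.idx s) P)
    (h : NearChain (M := cyclicFamily P) (s := s) j x y) :
    ∃ d : ℤ, |d| ≤ 2 * j ∧ (y.idx : ℤ) ≡ x.idx + d [ZMOD (CyclicSort.idx s : ℕ)] := by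
  induction j generalizing x with
  | zero => exact ⟨0, by simp, by rw [show x = y from h, add_zero]⟩
  | succ j ih =>
    obtain ⟨z, ⟨e, hx, hz⟩, hzy⟩ := h
    obtain ⟨d, hd, hdy⟩ := ih z hzy
    obtain ⟨r, hr₀, hr₂, hr⟩ := idx_of_C_rot hn (e := e) (x := x) hx
    obtain ⟨r', hr₀', hr₂', hr'⟩ := idx_of_C_rot hn (e := e) (x := z) hz
    -- Both `x` and `z` are at most two copies after `e`, so the step from `x` to `z` contributes
    -- `r' - r`, between -2 and 2.
    refine ⟨d + r' - r, ?_, hdy.trans ?_⟩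
    · rw [abs_le] at hd ⊢
      push_cast
      constructor <;> linarith [hd.1, hd.2]
    · refine (hr'.add_right d).trans ?_
      have := hr.symm.add_right (d + r' - r)
      refine Int.ModEq.trans (by ring_nf; rfl) this

end CyclicPow

/-! ### Lower bounds in arbitrary models of the theory -/

section LowerBound

variable {P : Type u} [PartialOrder P] {C : cyclicFamilyLanguage.{u}.Str.{u, u}}
  {s : cyclicFamilyLanguage.{u}.Srt}

theorem not_nearChain_of_models (hT : C.Models (cyclicFamily P).theory) {m j : ℕ} (hj : j ≤ m)
    (hs : (CyclicSort.idx s : ℕ) = 4 * m + 3) (x : C.carrier s) :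
    ¬ NearChain j x (rotVal^[2 * m + 1] x) := by
  let χ : Sentence cyclicFamilyLanguage.{u} := .all s (.neg
    (nearChainFormula j .bvarZero (rotTerm^[2 * m + 1] .bvarZero)))
  have key : (cyclicFamily P).Realize χ (fun i => i.elim) := by
    intro x h
    rw [bRealize_nearChainFormula, termVal_rotTerm_iterate, termVal_bvarZero] at h
    obtain ⟨d, hd, hdx⟩ := CyclicPow.idx_of_nearChain (by omega) j _ _ h
    have h₂ := CyclicPow.idx_rot_iterate (P := P) (n := CyclicSort.idx s) x (2 * m + 1)
    have h₃ := (h₂.symm.trans hdx).add_left_cancel' _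
    -- With `|d| ≤ 2 * m`, the difference `d - (2 * m + 1)` is nonzero and of absolute value at most
    -- `4 * m + 1`, so `4 * m + 3` cannot divide it.
    have h₄ := Int.eq_zero_of_abs_lt_dvd h₃.dvd
    rw [abs_le] at hd
    rw [abs_lt] at h₄
    push_cast at h₄
    omega
  have h := (hT.realize_iff _).2 key x
  rwa [bRealize_neg, bRealize_nearChainFormula, termVal_rotTerm_iterate, termVal_bvarZero] at h

/-- Fewer rotations than the index of the sort suffice in $C_n(P)$, so the covering by arcs is a
first-order sentence. -/
theorem exists_cycVal_of_models (hT : C.Models (cyclicFamily P).theory)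
    (hs : 3 ≤ (CyclicSort.idx s : ℕ)) (e x : C.carrier s) :
    ∃ k : ℕ, CycVal (rotVal^[k] e) x (rotVal^[k + 2] e) := by
  let χ : Sentence cyclicFamilyLanguage.{u} := .all s (.all s (.neg
    (noArcFormula (Term.bvarZero.lift s) .bvarZero (CyclicSort.idx s : ℕ))))
  have key : (cyclicFamily P).Realize χ (fun i => i.elim) := by
    intro e x h
    rw [bRealize_noArcFormula, termVal_lift, termVal_bvarZero, termVal_bvarZero] at h
    obtain ⟨k, hk, hC⟩ := CyclicPow.exists_C_rot (P := P) (n := CyclicSort.idx s) hs e x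
    exact h k hk hC
  have h := (hT.realize_iff _).2 key e x
  rw [bRealize_neg, bRealize_noArcFormula, termVal_lift, termVal_bvarZero, termVal_bvarZero] at h
  push Not at h
  obtain ⟨k, -, hk⟩ := h
  exact ⟨k, hk⟩

variable {ι : Type v} {σ : ι → cyclicFamilyLanguage.{u}.Srt}

/-- An arc that starts at a rotation of an element of the model is definable over the model, so it
contains `b i` if it contains `a i`. -/
theorem near_of_lascarAdj (hT : C.Models (cyclicFamily P).theory) {a b : C.Tuple σ}
    (h : C.LascarAdj a b) {i : ι} (hi : 3 ≤ (CyclicSort.idx (σ i) : ℕ)) : Near (a i) (b i) := by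
  obtain ⟨N, f, h⟩ := h
  obtain ⟨e⟩ : Nonempty (N.carrier (σ i)) := by
    by_contra hN
    have h₁ : N.Realize (BFormula.all (σ i) .falsum : Sentence cyclicFamilyLanguage)
      (fun i : PEmpty => i.elim) := fun x => hN ⟨x⟩
    rw [← f.realize_iff] at h₁
    exact h₁ (a i)
  obtain ⟨k, hk⟩ := exists_cycVal_of_models hT hi (f.toFun _ e) (a i)
  let τ := Sum.elim σ fun x : (Σ s, N.carrier s) => x.1
  let te : Term cyclicFamilyLanguage τ [] (σ i) := .var (σ := τ) (.inr ⟨σ i, e⟩)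
  let tx : Term cyclicFamilyLanguage τ [] (σ i) := .var (σ := τ) (.inl i)
  have key := h (cycFormula (rotTerm^[k] te) tx (rotTerm^[k + 2] te))
  rw [Realize, Realize, bRealize_cycFormula, bRealize_cycFormula, termVal_rotTerm_iterate,
    termVal_rotTerm_iterate, termVal_rotTerm_iterate, termVal_rotTerm_iterate] at key
  have hk' := key.1 hk
  rw [Function.iterate_succ_apply', Function.iterate_succ_apply'] at hk hk'
  exact ⟨_, hk, hk'⟩

theorem nearChain_of_lascarLE (hT : C.Models (cyclicFamily P).theory) {a b : C.Tuple σ} {j : ℕ}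
    (h : C.LascarLE j a b) {i : ι} (hi : 3 ≤ (CyclicSort.idx (σ i) : ℕ)) :
    NearChain j (a i) (b i) := by
  induction j generalizing a with
  | zero =>
    obtain ⟨x, rfl, rfl, -⟩ := h
    rfl
  | succ j ih =>
    obtain ⟨x, rfl, rfl, hx⟩ := h
    exact ⟨x 1 i, near_of_lascarAdj hT (hx 0 j.succ_pos) hi,
      ih ⟨fun l => x (l + 1), rfl, rfl, fun l hl => hx _ (by omega)⟩⟩

theorem lt_lascarDist (hT : C.Models (cyclicFamily P).theory) {a b : C.Tuple σ} {m : ℕ} {i : ι}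
    (hi : (CyclicSort.idx (σ i) : ℕ) = 4 * m + 3) (hab : b i = rotVal^[2 * m + 1] (a i)) :
    (m : ℕ∞) < C.lascarDist a b := by
  refine lt_of_lt_of_le (b := ((m + 1 : ℕ) : ℕ∞)) (by exact_mod_cast m.lt_succ_self)
    (le_iInf₂ fun j hj => ?_)
  by_contra hlt
  have hjm : j ≤ m := by
    rw [not_le] at hlt
    have : j < m + 1 := by exact_mod_cast hlt
    omega
  have := nearChain_of_lascarLE hT hj (i := i) (by omega)
  rw [hab] at this
  exact not_nearChain_of_models hT hjm hi _ this

end LowerBound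

/-! ## The interpretation of `(C_n(P))_n` in `P` -/

section Coding

variable {P : Type u}

open Classical in
/-- The index coded by a tuple: the first `j` such that the entry `j + 1` equals the entry `0`. -/
noncomputable def codeIdx (n : ℕ+) (v : Fin (n + 1) → P) : Fin n :=
  if h : (Finset.univ.filter fun j : Fin n => v j.succ = v 0).Nonempty then
    (Finset.univ.filter fun j : Fin n => v j.succ = v 0).min' h else ⟨0, n.pos⟩

/-- The right side combines finitely many equalities of entries with conditions not depending on
`v`, as definability requires. The last disjunct is the default value 0. -/
theorem codeIdx_eq_iff {n : ℕ+} {v : Fin (n + 1) → P} {i : Fin n} :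
    codeIdx n v = i ↔ (v i.succ = v 0 ∧ ∀ j, ¬ (j < i ∧ v j.succ = v 0)) ∨
      ((∀ j : Fin n, ¬ v j.succ = v 0) ∧ (⟨0, n.pos⟩ : Fin n) = i) := by
  classical
  unfold codeIdx
  split_ifs with h
  · rw [Finset.min'_eq_iff]
    obtain ⟨j, hj⟩ := h
    simp only [Finset.mem_filter_univ] at hj ⊢
    constructor
    · rintro ⟨h₁, h₂⟩
      exact Or.inl ⟨h₁, fun j hj => (h₂ j hj.2).not_gt hj.1⟩
    · rintro (⟨h₁, h₂⟩ | ⟨h₁, -⟩)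
      · exact ⟨h₁, fun j hj => not_lt.1 fun hlt => h₂ j ⟨hlt, hj⟩⟩
      · exact absurd hj (h₁ j)
  · simp only [Finset.not_nonempty_iff_eq_empty, Finset.filter_eq_empty_iff, Finset.mem_univ,
      true_imp_iff] at h
    exact ⟨fun hi => Or.inr ⟨fun j => h (x := j), hi⟩,
      fun hi => hi.elim (fun h' => absurd h'.1 (h (x := i))) And.right⟩

/-- The element of `C_n(P)` coded by a tuple. -/
noncomputable def code (n : ℕ+) (v : Fin (n + 1) → P) : CyclicPow n P :=
  CyclicPow.mk (v 0) (codeIdx n v)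

theorem code_surjective [Nontrivial P] (n : ℕ+) : Function.Surjective (code (P := P) n) := by
  classical
  intro x
  obtain ⟨q, hq⟩ := exists_ne x.pt
  -- A second element `q` fills the entries that must differ from entry 0.
  refine ⟨Fin.cons x.pt fun j => if j = x.idx then x.pt else q, ?_⟩
  have : codeIdx n (Fin.cons x.pt fun j => if j = x.idx then x.pt else q) = x.idx := by
    refine codeIdx_eq_iff.2 (Or.inl ⟨by simp, fun j hj => ?_⟩)
    simp [hj.1.ne, hq] at hj
  rw [code, this]
  rfl

end Coding

section Definable

variable {P : Type u} [FirstOrder.Language.order.Structure P] {α : Type v}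

theorem definable_apply_eq (a b : α) :
    (∅ : Set P).Definable FirstOrder.Language.order {v : α → P | v a = v b} := by
  rw [Set.empty_definable_iff]
  exact ⟨(Language.Term.var a).equal (Language.Term.var b), by
    ext; simp [Language.Formula.realize_equal]⟩

theorem definable_congr {s t : Set (α → P)}
    (h : (∅ : Set P).Definable FirstOrder.Language.order s) (e : ∀ v, v ∈ t ↔ v ∈ s) :
    (∅ : Set P).Definable FirstOrder.Language.order t :=
  Set.ext e ▸ h

theorem definable_setOf_const (p : Prop) :
    (∅ : Set P).Definable FirstOrder.Language.order {_v : α → P | p} := by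
  by_cases h : p <;> simp [h]

theorem definable_setOf_forall {β : Type w} [Finite β] {p : β → (α → P) → Prop}
    (h : ∀ j, (∅ : Set P).Definable FirstOrder.Language.order {v | p j v}) :
    (∅ : Set P).Definable FirstOrder.Language.order {v | ∀ j, p j v} := by
  rw [Set.ofPred_forall]
  exact Set.definable_iInter_of_finite h

theorem definable_setOf_exists {β : Type w} [Finite β] {p : β → (α → P) → Prop}
    (h : ∀ j, (∅ : Set P).Definable FirstOrder.Language.order {v | p j v}) :
    (∅ : Set P).Definable FirstOrder.Language.order {v | ∃ j, p j v} := by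
  rw [Set.ofPred_exists]
  exact Set.definable_iUnion_of_finite h

theorem definable_codeIdx_eq (n : ℕ+) (i : Fin n) :
    (∅ : Set P).Definable FirstOrder.Language.order {v | codeIdx n v = i} := by
  simp only [codeIdx_eq_iff]
  exact ((definable_apply_eq _ _).inter (definable_setOf_forall fun j =>
    ((definable_setOf_const _).inter (definable_apply_eq _ _)).compl)).union
    ((definable_setOf_forall fun j => (definable_apply_eq _ _).compl).inter
      (definable_setOf_const _))

/-- A case distinction over the finitely many values of the index replaces it by a constant. -/
theorem definable_of_codeIdx {n : ℕ+} (f : Fin (n + 1) → α) {R : Fin n → (α → P) → Prop}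
    (h : ∀ i, (∅ : Set P).Definable FirstOrder.Language.order {v | R i v}) :
    (∅ : Set P).Definable FirstOrder.Language.order {v | R (codeIdx n (v ∘ f)) v} := by
  have : {v : α → P | R (codeIdx n (v ∘ f)) v} = {v | ∃ i, codeIdx n (v ∘ f) = i ∧ R i v} := by
    ext; simp
  rw [this]
  exact definable_setOf_exists fun i => ((definable_codeIdx_eq n i).preimage_comp f).inter (h i)

/-- With `e` the identity this defines equality of coded elements, with `e` the rotation of the
indices the graph of $R_n$. -/
theorem definable_mk_eq_code {n : ℕ+} (e : Fin n → Fin n) (f g : Fin (n + 1) → α) :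
    (∅ : Set P).Definable FirstOrder.Language.order
      {v : α → P | CyclicPow.mk (v (f 0)) (e (codeIdx n (v ∘ f))) = code n (v ∘ g)} := by
  have (p q : P) (i j : Fin n) : CyclicPow.mk p i = CyclicPow.mk q j ↔ i = j ∧ p = q :=
    Prod.ext_iff
  simp only [code, this]
  exact definable_of_codeIdx f (R := fun i v => e i = codeIdx n (v ∘ g) ∧ v (f 0) = v (g 0))
    fun i => definable_of_codeIdx g (R := fun j v => e i = j ∧ v (f 0) = v (g 0))
      fun j => (definable_setOf_const _).inter (definable_apply_eq _ _)

variable [PartialOrder P] [FirstOrder.Language.order.OrderedStructure P]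

theorem definable_apply_lt (a b : α) :
    (∅ : Set P).Definable FirstOrder.Language.order {v : α → P | v a < v b} := by
  rw [Set.empty_definable_iff]
  exact ⟨Language.Term.lt (n := 0) (Language.Term.var (Sum.inl a)) (Language.Term.var (Sum.inl b)),
    by ext; simp [Language.Formula.Realize, Language.Term.realize_lt]⟩

theorem definable_code_lt {n : ℕ+} (f g : Fin (n + 1) → α) :
    (∅ : Set P).Definable FirstOrder.Language.order
      {v : α → P | CyclicPow.lt (code n (v ∘ f)) (code n (v ∘ g))} := by
  simp only [CyclicPow.lt_iff]
  exact definable_of_codeIdx f (R := fun i v => (i : ℕ) < codeIdx n (v ∘ g) ∨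
      (i : ℕ) = codeIdx n (v ∘ g) ∧ v (f 0) < v (g 0)) fun i =>
    definable_of_codeIdx g (R := fun j v => (i : ℕ) < j ∨ (i : ℕ) = j ∧ v (f 0) < v (g 0))
      fun j => (definable_setOf_const _).union
        ((definable_setOf_const _).inter (definable_apply_lt _ _))

/-- The interpretation of `(C_n(P))_n` in `P`, without parameters. -/
noncomputable def cyclicInterpretation [Nontrivial P] :
    MSInterpretation FirstOrder.Language.order P ∅ (cyclicFamily P) where
  dim s := CyclicSort.idx s + 1
  dom s := Set.univ
  proj s v := code (CyclicSort.idx s) v.1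
  proj_surjective s x := by
    obtain ⟨v, hv⟩ := code_surjective (CyclicSort.idx s) x
    exact ⟨⟨v, trivial⟩, hv⟩
  dom_definable s := Set.definable_univ
  eq_definable s :=
    definable_congr (definable_mk_eq_code id Sum.inl Sum.inr) fun v =>
      ⟨fun ⟨_, _, h⟩ => h, fun h => ⟨trivial, trivial, h⟩⟩
  rel_definable := by
    rintro _ ⟨s⟩
    let α := Σ i : Fin [s, s, s].length, Fin (CyclicSort.idx ([s, s, s].get i) + 1)
    let f₀ : Fin (CyclicSort.idx s + 1) → α := fun k => ⟨0, k⟩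
    let f₁ : Fin (CyclicSort.idx s + 1) → α := fun k => ⟨1, k⟩
    let f₂ : Fin (CyclicSort.idx s + 1) → α := fun k => ⟨2, k⟩
    have h₀₁ := definable_code_lt (P := P) f₀ f₁
    have h₁₂ := definable_code_lt (P := P) f₁ f₂
    have h₂₀ := definable_code_lt (P := P) f₂ f₀
    refine definable_congr ((h₀₁.inter h₁₂).union ((h₁₂.inter h₂₀).union (h₂₀.inter h₀₁)))
      fun v => ⟨?_, fun h => ⟨fun _ => trivial, ?_⟩⟩
    · exact fun ⟨_, h⟩ => h
    · exact h
  fun_definable := by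
    rintro _ s ⟨⟩
    let α := (Σ i : Fin [s].length, Fin (CyclicSort.idx ([s].get i) + 1)) ⊕
      Fin (CyclicSort.idx s + 1)
    let f : Fin (CyclicSort.idx s + 1) → α := fun k => .inl ⟨0, k⟩
    refine definable_congr (definable_mk_eq_code (finRotate (CyclicSort.idx s)) f Sum.inr)
      fun v => ⟨?_, fun h => ⟨fun _ => trivial, trivial, ?_⟩⟩
    · exact fun ⟨_, _, h⟩ => h
    · exact h

end Definable

/-! ## The main theorem -/

/-- $C_1(Q)$ is elementarily equivalent to $C_1(Q^{\oplus 3})$, which has two elements because `Q`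
is nonempty. -/
theorem WeaklyCyclicallyThreeSplitting.nontrivial {P : Type u} [PartialOrder P] [Nonempty P]
    (hP : WeaklyCyclicallyThreeSplitting P) : Nontrivial P := by
  obtain ⟨Q, _, hQ, hPQ⟩ := hP
  let q : Q := ((hPQ 1).some (CyclicPow.mk (Classical.arbitrary P) 0)).pt
  obtain ⟨⟨f, -⟩, -⟩ := hQ 1
  have e := f.elementarilyEquivalent
  have h₃ : CyclicPow 1 (LinPow 3 Q) ⊨ Language.Sentence.cardGe cyclicLanguage 2 := by
    rw [Language.Sentence.realize_cardGe, Nat.cast_ofNat, Cardinal.two_le_iff]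
    refine ⟨CyclicPow.mk (toLex (0, q)) 0, CyclicPow.mk (toLex (1, q)) 0, fun h => ?_⟩
    have h' : (0 : Fin 3) = 1 := congrArg (fun x => (ofLex (CyclicPow.pt x)).1) h
    exact absurd h' (by decide)
  rw [← e.realize_sentence, Language.Sentence.realize_cardGe, Nat.cast_ofNat,
    Cardinal.two_le_iff] at h₃
  obtain ⟨x, y, hxy⟩ := h₃
  let g := (hPQ 1).some.symm
  refine ⟨(g x).pt, (g y).pt, fun h => hxy (g.injective ?_)⟩
  exact Prod.ext (Subsingleton.elim (α := Fin 1) _ _) h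

theorem MSLanguage.Str.lascarDist_le_of_sequence {L : MSLanguage.{u}} {C : L.Str.{u, u}}
    {ι : Type v} {σ : ι → L.Srt} {X : ℕ → C.Tuple σ} (hX : ∀ t, C.LascarAdj (X t) (X (t + 1)))
    (t : ℕ) : C.lascarDist (X 0) (X t) ≤ t :=
  iInf₂_le t ⟨X, rfl, rfl, fun i _ => hX i⟩

theorem eq_rotVal_iterate_of_sequence {C : cyclicFamilyLanguage.{u}.Str.{u, u}}
    {X : ℕ → C.Tuple fun s : cyclicFamilyLanguage.{u}.Srt => s}
    (hX : ∀ t s, X (t + 3) s = rotVal (X t s)) (k : ℕ) (s : cyclicFamilyLanguage.{u}.Srt) :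
    X (3 * k) s = rotVal^[k] (X 0 s) := by
  induction k with
  | zero => rfl
  | succ k ih => rw [Function.iterate_succ_apply', ← ih, Nat.mul_succ, hX]

theorem exists_lascarEquiv_lt_lascarDist {P : Type u} [PartialOrder P] [Nonempty P]
    (hP : WeaklyCyclicallyThreeSplitting P) {κ : Cardinal.{u}}
    {C : cyclicFamilyLanguage.{u}.Str.{u, u}} (hC : C.IsMonster κ)
    (hT : C.Models (cyclicFamily P).theory) (m : ℕ) :
    ∃ (n : ℕ+) (a b : C.carrier ⟨n⟩), C.LascarEquiv (cyclicSingle a) (cyclicSingle b) ∧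
      (m : ℕ∞) < C.lascarDist (cyclicSingle a) (cyclicSingle b) := by
  obtain ⟨X, hX, hrot⟩ := exists_lascarAdj_sequence hP hC hT
  let s : cyclicFamilyLanguage.{u}.Srt := (⟨⟨4 * m + 3, by omega⟩⟩ : CyclicSort.{u})
  refine ⟨⟨4 * m + 3, by omega⟩, X 0 s, X (3 * (2 * m + 1)) s, ?_, ?_⟩
  · exact (lascarDist_le_of_sequence (fun t => (hX t).comp fun _ : Unit => s) _).trans_lt
      (ENat.natCast_lt_top _)
  · exact lt_lascarDist hT (i := ()) rfl (eq_rotVal_iterate_of_sequence hrot _ _)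

/-- The tuple `X 0` has an entry in every sort, and the sort `4 * m + 3` refutes the candidate bound
`m` for its Lascar strong type. -/
theorem not_isGCompact_cyclicFamily {P : Type u} [PartialOrder P] [Nonempty P]
    (hP : WeaklyCyclicallyThreeSplitting P) : ¬ (cyclicFamily P).theory.IsGCompact := by
  rintro ⟨κ, C, hC, hT, h⟩
  obtain ⟨X, hX, hrot⟩ := exists_lascarAdj_sequence hP hC hT
  have : Countable cyclicFamilyLanguage.{u}.Srt :=
    Function.Injective.countable (f := CyclicSort.idx) fun ⟨_⟩ ⟨_⟩ h => congrArg _ h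
  obtain ⟨m, hm⟩ := h _ (fun s => s)
    (Cardinal.mk_le_aleph0.trans_lt ((le_max_left _ _).trans_lt hC.lt)) (X 0)
  let s : cyclicFamilyLanguage.{u}.Srt := (⟨⟨4 * m + 3, by omega⟩⟩ : CyclicSort.{u})
  refine (hm (X (3 * (2 * m + 1))) ?_).not_gt ?_
  · exact (lascarDist_le_of_sequence hX _).trans_lt (ENat.natCast_lt_top _)
  · exact lt_lascarDist hT (i := s) rfl (eq_rotVal_iterate_of_sequence hrot _ _)

/-- Every set that is definable over `A` is definable over a larger set of parameters. -/
def MSInterpretation.mono {L : FirstOrder.Language.{v, w}} {M : Type u} [L.Structure M]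
    {A B : Set M} {L' : MSLanguage.{u}} {N : L'.Str.{u, u}} (I : MSInterpretation L M A N)
    (h : A ⊆ B) : MSInterpretation L M B N where
  dim := I.dim
  dom := I.dom
  proj := I.proj
  proj_surjective := I.proj_surjective
  dom_definable s := (I.dom_definable s).mono h
  eq_definable s := (I.eq_definable s).mono h
  rel_definable R := (I.rel_definable R).mono h
  fun_definable f := (I.fun_definable f).mono h

theorem mainTheorem2 {P : Type u} [PartialOrder P] [Nonempty P] [FirstOrder.Language.order.Structure P]
    [FirstOrder.Language.order.OrderedStructure P] (hP : WeaklyCyclicallyThreeSplitting P) :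
    ¬ HereditarilyGCompact.{u} (FirstOrder.Language.order.completeTheory P) ∧
    Nonempty (MSInterpretation FirstOrder.Language.order P ∅ (cyclicFamily P)) ∧
    (∀ (κ : Cardinal.{u}) (C : cyclicFamilyLanguage.{u}.Str.{u, u}), C.IsMonster κ →
      C.Models (cyclicFamily P).theory → ∀ m : ℕ, ∃ (n : ℕ+) (a b : C.carrier ⟨n⟩),
        C.LascarEquiv (cyclicSingle a) (cyclicSingle b) ∧
          (m : ℕ∞) < C.lascarDist (cyclicSingle a) (cyclicSingle b)) ∧
    ¬ (cyclicFamily P).theory.IsGCompact := by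
  have := hP.nontrivial
  exact ⟨fun h => not_isGCompact_cyclicFamily hP (h P cyclicFamilyLanguage (cyclicFamily P)
      ⟨cyclicInterpretation.mono (Set.empty_subset _)⟩), ⟨cyclicInterpretation⟩,
    fun κ C hC hT m => exists_lascarEquiv_lt_lascarDist hP hC hT m,
    not_isGCompact_cyclicFamily hP⟩
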